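/- Let $(N,g)$ be a smooth pseudo-Riemannian manifold of dimension $n$ (any signature), let $d\ge 0$, and let $x=(x^1,\dots,x^n)$ be local coordinates on a coordinate domain $U\subseteq N$, with canonical momenta $p_1,\dots,p_n$ and $H(x,p)=\tfrac12 g^{ij}(x)p_ip_j$. For $I_d=\sum_{|I|=d}a^I(x)\,p^I$, the coefficients $F_\tau$ ($|\tau|=d+1$) of $p^\tau$ in the Poisson bracket $$\{H,I_d\}=\sum_{i=1}^n\Bigl(\frac{\partial H}{\partial p_i}\frac{\partial I_d}{\partial x^i}-\frac{\partial H}{\partial x^i}\frac{\partial I_d}{\partial p_i}\Bigr)$$ are first order linear differential expressions in the unknown functions $a^I$; the system $\mathcal E_d=\{F_\tau=0\}$ is the Killing equation. Its $k$-th prolongation $\mathcal E_d^{(k)}$ consists of the equations $D_\beta F_\tau=0$, $|\tau|=d+1$, $|\beta|\le k$, where $D_\beta$ denotes iterated total derivatives. Written with respect to the variables $a^I_\alpha$, $|I|=d$, $|\alpha|\le k+1$, it has the coefficient matrix $M_k(x)$ (the $k$-th prolongation matrix). For $x_0\in U$ put $\delta_k=\operatorname{columns}(M_k(x_0))-\operatorname{rank}(M_k(x_0))$.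 The point $x_0$ is called regular if for every $k\ge0$ the function $x\mapsto\operatorname{rank}M_k(x)$ on $U$ attains its maximum at $x_0$. Let $K_d$ be the real vector space of germs at $x_0$ of smooth solutions of $\mathcal E_d$ (local Killing $d$-tensors). Algorithm (Cartan's prolongation–projection method). Start with $k=0$. Compute $\delta_k$. If $k\le d$, or if $k>d$ and $\delta_k\ne\delta_{k-1}$, increase $k$ by $1$ and repeat; otherwise return $(\delta_k,k)$. **Proposition.** Let $x_0$ be a regular point. Then the algorithm terminates, and it is correct: it returns $(\delta_k,k)$ for the first $k>d$ with $\delta_k=\delta_{k-1}$, the space $K_d$ is finite-dimensional, and $$\dim K_d=\delta_k .$$ Moreover, all compatibility conditions have then been found: for every $l\ge k-1$, each point of $\mathcal E_d^{(l)}$ over $x_0$ is the $(l+1)$-jet at $x_0$ of a local Killing $d$-tensor. For $d\le m<k-1$, on the other hand, the projection $\mathcal E_d^{(m+1)}\to\mathcal E_d^{(m)}$ is not surjective over $x_0$. -/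

import Mathlib

open scoped Manifold ContDiff Topology

noncomputable section

namespace KillingProlongation

/-! ### Coordinates, multi-indices, partial derivatives -/

/-- The coordinate space `ℝⁿ`; it serves both for positions `x` and for momenta `p`. -/
abbrev Coord (n : ℕ) : Type := EuclideanSpace ℝ (Fin n)

/-- The partial derivative `∂f/∂x^i`. -/
def pd {n : ℕ} (i : Fin n) (f : Coord n → ℝ) : Coord n → ℝ :=
  fun x => fderiv ℝ f x (EuclideanSpace.single i 1)

/-- The iterated operator `D_1^{β_1} ∘ ⋯ ∘ D_n^{β_n}` for a multi-index `β`. -/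
def iterOp {n : ℕ} {A : Type*} (D : Fin n → A → A) (β : Fin n →₀ ℕ) (F : A) : A :=
  (List.finRange n).foldr (fun q G => (D q)^[β q] G) F

/-- Multi-indices `σ` in `n` variables with `|σ| = m`. -/
abbrev MultiEq (n m : ℕ) : Type := {σ : Fin n →₀ ℕ // σ.degree = m}

/-- Multi-indices `σ` in `n` variables with `|σ| ≤ m`. -/
abbrev MultiLE (n m : ℕ) : Type := {σ : Fin n →₀ ℕ // σ.degree ≤ m}

instance instFintypeMultiEq (n m : ℕ) : Fintype (MultiEq n m) :=
  (Finsupp.finite_of_degree_eq (σ := Fin n) m).fintype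

instance instFintypeMultiLE (n m : ℕ) : Fintype (MultiLE n m) :=
  (Finsupp.finite_of_degree_le (σ := Fin n) m).fintype

/-! ### Pseudo-Riemannian metrics -/

/-- The matrix `g_{ij}(x) = g(∂_i, ∂_j)` of a field of bilinear forms in the local coordinates
given by the chart `φ` (meaningful for `x ∈ φ.target`). -/
def metricCoord {n : ℕ} {N : Type*} [TopologicalSpace N] [ChartedSpace (Coord n) N]
    (b : ∀ x : N, LinearMap.BilinForm ℝ (TangentSpace (𝓡 n) x))
    (φ : OpenPartialHomeomorph N (Coord n)) (x : Coord n) : Matrix (Fin n) (Fin n) ℝ :=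
  Matrix.of fun i j =>
    b (φ.symm x)
      (mfderiv (𝓡 n) (𝓡 n) φ.symm x (EuclideanSpace.single i (1 : ℝ) : Coord n))
      (mfderiv (𝓡 n) (𝓡 n) φ.symm x (EuclideanSpace.single j (1 : ℝ) : Coord n))

/-- A smooth pseudo-Riemannian metric (of arbitrary signature) on a smooth `n`-manifold: a field of
nondegenerate symmetric bilinear forms on the tangent spaces, with smooth components in every
smooth chart. -/
structure PseudoRiemannianMetric (n : ℕ) (N : Type*) [TopologicalSpace N]
    [ChartedSpace (Coord n) N] where
  form : ∀ x : N, LinearMap.BilinForm ℝ (TangentSpace (𝓡 n) x)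
  symm : ∀ x, (form x).IsSymm
  nondegenerate : ∀ x, (form x).Nondegenerate
  smooth : ∀ φ ∈ IsManifold.maximalAtlas (𝓡 n) ∞ N, ∀ i j,
    ContDiffOn ℝ ∞ (fun x => metricCoord form φ x i j) φ.target

/-- The matrix function `x ↦ [g_{ij}(x)]` of the metric in the chart `φ`. -/
def PseudoRiemannianMetric.inChart {n : ℕ} {N : Type*} [TopologicalSpace N]
    [ChartedSpace (Coord n) N] (g : PseudoRiemannianMetric n N)
    (φ : OpenPartialHomeomorph N (Coord n)) : Coord n → Matrix (Fin n) (Fin n) ℝ :=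
  metricCoord g.form φ

/-! ### Hamiltonian, Poisson bracket, Killing tensors

From here on, `G` is the matrix function `x ↦ [g_{ij}(x)]` of the metric in local coordinates. -/

/-- `H(x,p) = ½ g^{ij}(x) p_i p_j`, with `[g^{ij}] = [g_{ij}]⁻¹`. -/
def hamiltonian {n : ℕ} (G : Coord n → Matrix (Fin n) (Fin n) ℝ) (x p : Coord n) : ℝ :=
  1 / 2 * ∑ i, ∑ j, (G x)⁻¹ i j * p i * p j

/-- `{H, I} = ∑ i, (∂H/∂p_i ∂I/∂x^i - ∂H/∂x^i ∂I/∂p_i)` for functions of `(x, p)`. -/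
def poissonBracket {n : ℕ} (H I : Coord n → Coord n → ℝ) (x p : Coord n) : ℝ :=
  ∑ i, (pd i (fun p' => H x p') p * pd i (fun x' => I x' p) x
    - pd i (fun x' => H x' p) x * pd i (fun p' => I x p') p)

/-- The function `I_d(x,p) = ∑_{|I| = d} a^I(x) p^I`, homogeneous of degree `d` in the momenta. -/
def momentumPoly {n d : ℕ} (a : MultiEq n d → Coord n → ℝ) (x p : Coord n) : ℝ :=
  ∑ I : MultiEq n d, a I x * ∏ i, p i ^ (I.1 i)

/-- `a = (a^I)` is (the tuple of components of) a smooth Killing `d`-tensor on the open set `U`: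
the function `I_d` with these coefficients Poisson commutes with the Hamiltonian over `U`. -/
def IsKillingOn {n d : ℕ} (G : Coord n → Matrix (Fin n) (Fin n) ℝ) (U : Set (Coord n))
    (a : MultiEq n d → Coord n → ℝ) : Prop :=
  (∀ I, ContDiffOn ℝ ∞ (a I) U) ∧
    ∀ x ∈ U, ∀ p, poissonBracket (hamiltonian G) (momentumPoly a) x p = 0

lemma pd_lin {n : ℕ} (i : Fin n) {f h : Coord n → ℝ} {x : Coord n} (c : ℝ)
    (hf : DifferentiableAt ℝ f x) (hh : DifferentiableAt ℝ h x) :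
    pd i (fun y => c * f y + h y) x = c * pd i f x + pd i h x := by
  have h1 : HasFDerivAt (fun y => c * f y + h y) (c • fderiv ℝ f x + fderiv ℝ h x) x :=
    (hf.hasFDerivAt.const_mul c).add hh.hasFDerivAt
  simp only [pd, h1.fderiv]
  simp

lemma differentiable_momentumPoly_snd {n d : ℕ} (a : MultiEq n d → Coord n → ℝ) (x : Coord n) :
    Differentiable ℝ (fun p => momentumPoly a x p) := by
  unfold momentumPoly
  fun_prop

lemma differentiableAt_momentumPoly_fst {n d : ℕ} {a : MultiEq n d → Coord n → ℝ} {x : Coord n}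
    (ha : ∀ I, DifferentiableAt ℝ (a I) x) (p : Coord n) :
    DifferentiableAt ℝ (fun y => momentumPoly a y p) x := by
  unfold momentumPoly
  fun_prop

lemma IsKillingOn.smul_add {n d : ℕ} {G : Coord n → Matrix (Fin n) (Fin n) ℝ}
    {U : Set (Coord n)} (hU : IsOpen U) {a b : MultiEq n d → Coord n → ℝ} (c : ℝ)
    (ha : IsKillingOn G U a) (hb : IsKillingOn G U b) : IsKillingOn G U (c • a + b) := by
  refine ⟨fun I => (contDiffOn_const.mul (ha.1 I)).add (hb.1 I), fun x hx p => ?_⟩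
  have da : ∀ I, DifferentiableAt ℝ (a I) x := fun I =>
    ((ha.1 I).contDiffAt (hU.mem_nhds hx)).differentiableAt (by simp)
  have db : ∀ I, DifferentiableAt ℝ (b I) x := fun I =>
    ((hb.1 I).contDiffAt (hU.mem_nhds hx)).differentiableAt (by simp)
  have hm : ∀ y q, momentumPoly (c • a + b) y q = c * momentumPoly a y q + momentumPoly b y q := by
    intro y q
    simp only [momentumPoly, Finset.mul_sum, ← Finset.sum_add_distrib]
    refine Finset.sum_congr rfl fun I _ => ?_
    simp only [Pi.add_apply, Pi.smul_apply, smul_eq_mul]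
    ring
  have key : poissonBracket (hamiltonian G) (momentumPoly (c • a + b)) x p
      = c * poissonBracket (hamiltonian G) (momentumPoly a) x p
        + poissonBracket (hamiltonian G) (momentumPoly b) x p := by
    simp only [poissonBracket, hm, Finset.mul_sum, ← Finset.sum_add_distrib]
    refine Finset.sum_congr rfl fun i _ => ?_
    rw [pd_lin i c (differentiableAt_momentumPoly_fst da p) (differentiableAt_momentumPoly_fst db p),
      pd_lin i c (differentiable_momentumPoly_snd a x p) (differentiable_momentumPoly_snd b x p)]
    ring
  rw [key, ha.2 x hx p, hb.2 x hx p]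
  simp

/-- Tuples of functions whose restriction to some open neighbourhood of `x₀` is a smooth Killing
`d`-tensor. -/
def killingNear {n : ℕ} (G : Coord n → Matrix (Fin n) (Fin n) ℝ) (d : ℕ) (x₀ : Coord n) :
    Submodule ℝ (MultiEq n d → Coord n → ℝ) where
  carrier := {a | ∃ U, IsOpen U ∧ x₀ ∈ U ∧ IsKillingOn G U a}
  zero_mem' := by
    refine ⟨Set.univ, isOpen_univ, Set.mem_univ _, fun I => contDiffOn_const, fun x _ p => ?_⟩
    simp [poissonBracket, momentumPoly, pd]
  add_mem' := by
    rintro a b ⟨U, hU, hxU, ha⟩ ⟨W, hW, hxW, hb⟩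
    refine ⟨U ∩ W, hU.inter hW, ⟨hxU, hxW⟩, ?_⟩
    have := IsKillingOn.smul_add (G := G) (hU.inter hW) (a := a) (b := b) 1
      ⟨fun I => (ha.1 I).mono Set.inter_subset_left, fun x hx => ha.2 x hx.1⟩
      ⟨fun I => (hb.1 I).mono Set.inter_subset_right, fun x hx => hb.2 x hx.2⟩
    simpa using this
  smul_mem' := by
    rintro c a ⟨U, hU, hxU, ha⟩
    have h0 : IsKillingOn G U (0 : MultiEq n d → Coord n → ℝ) :=
      ⟨fun I => contDiffOn_const, fun x _ p => by simp [poissonBracket, momentumPoly, pd]⟩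
    exact ⟨U, hU, hxU, by simpa using IsKillingOn.smul_add hU c ha h0⟩

/-- Tuples of functions that vanish identically near `x₀`. -/
def vanishNear (n d : ℕ) (x₀ : Coord n) : Submodule ℝ (MultiEq n d → Coord n → ℝ) where
  carrier := {a | ∀ᶠ x in 𝓝 x₀, ∀ I, a I x = 0}
  zero_mem' := by simp
  add_mem' := by
    intro a b ha hb
    filter_upwards [ha, hb] with x h1 h2 I
    simp [h1 I, h2 I]
  smul_mem' := by
    intro c a ha
    filter_upwards [ha] with x h1 I
    simp [h1 I]

/-- The space `K_d` of local Killing `d`-tensors at `x₀`, i.e. of germs at `x₀` of smooth solutions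
of the Killing equation. -/
abbrev KillingGerms {n : ℕ} (G : Coord n → Matrix (Fin n) (Fin n) ℝ) (d : ℕ) (x₀ : Coord n) :
    Type :=
  killingNear G d x₀ ⧸ (vanishNear n d x₀).submoduleOf (killingNear G d x₀)

/-! ### The Killing equation in jet variables and its prolongations -/

/-- A linear differential expression `F = ∑ F_{I,α}(x) a^I_α` in the jet variables `a^I_α`
(`|I| = d`, `α` any multi-index), given by its coefficient functions `F_{I,α}`. -/
abbrev LinJet (n d : ℕ) : Type := MultiEq n d → (Fin n →₀ ℕ) → Coord n → ℝ

/-- The Hamiltonian at `x` as a polynomial in the momenta. -/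
def hamiltonianPoly {n : ℕ} (G : Coord n → Matrix (Fin n) (Fin n) ℝ) (x : Coord n) :
    MvPolynomial (Fin n) ℝ :=
  ∑ j, ∑ k, MvPolynomial.C (1 / 2 * (G x)⁻¹ j k) * MvPolynomial.X j * MvPolynomial.X k

/-- The derivative `∂H/∂x^i` at `x` as a polynomial in the momenta. -/
def hamiltonianPolyDx {n : ℕ} (G : Coord n → Matrix (Fin n) (Fin n) ℝ) (i : Fin n) (x : Coord n) :
    MvPolynomial (Fin n) ℝ :=
  ∑ j, ∑ k, MvPolynomial.C (pd i (fun y => 1 / 2 * (G y)⁻¹ j k) x) *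
    MvPolynomial.X j * MvPolynomial.X k

/-- The coefficient of `p^τ` in `{H, I_d}`, as a first order linear expression in the jet variables
of `I_d = ∑ a^I p^I`. As `∂I_d/∂x^i = ∑ a^I_{1_i} p^I` and `∂I_d/∂p_i = ∑ a^I ∂p^I/∂p_i`, the
variable `a^I_{1_i}` occurs with the `p^τ`-coefficient of `∂H/∂p_i · p^I`, and `a^I_0` with
that of `-∑ i, ∂H/∂x^i · ∂p^I/∂p_i`. -/
def killingEquation {n : ℕ} (G : Coord n → Matrix (Fin n) (Fin n) ℝ) (d : ℕ)
    (τ : MultiEq n (d + 1)) : LinJet n d :=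
  fun I α x =>
    (∑ i, if α = Finsupp.single i 1 then
      MvPolynomial.coeff τ.1
        (MvPolynomial.pderiv i (hamiltonianPoly G x) * MvPolynomial.monomial I.1 1) else 0)
    - (if α = 0 then
        ∑ i, MvPolynomial.coeff τ.1
          (hamiltonianPolyDx G i x * MvPolynomial.pderiv i (MvPolynomial.monomial I.1 1)) else 0)

/-- The total derivative `D_q F = ∂F/∂x^q + ∑ ∂F/∂a^I_σ · a^I_{σ + 1_q}`, which for
`F = ∑ F_{I,α} a^I_α` has the coefficients `∂F_{I,α}/∂x^q + F_{I,α - 1_q}`. -/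
def totalDeriv {n d : ℕ} (q : Fin n) (F : LinJet n d) : LinJet n d :=
  fun I α x => pd q (F I α) x + if 1 ≤ α q then F I (α - Finsupp.single q 1) x else 0

/-- The index type of the variables `a^I_α`, `|I| = d`, `|α| ≤ k + 1`: fibre coordinates on the
`(k+1)`-jets of the unknowns `(a^I)`. -/
abbrev JetVar (n d k : ℕ) : Type := MultiEq n d × MultiLE n (k + 1)

/-- The `k`-th prolongation matrix `M_k(x)`: its rows are the equations `D_β F_τ`, `|τ| = d + 1`,
`|β| ≤ k`, of the prolongation `𝓔_d^{(k)}`, its columns the variables `a^I_α`. -/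
def prolongationMatrix {n : ℕ} (G : Coord n → Matrix (Fin n) (Fin n) ℝ) (d k : ℕ) (x : Coord n) :
    Matrix (MultiEq n (d + 1) × MultiLE n k) (JetVar n d k) ℝ :=
  Matrix.of fun r c => iterOp totalDeriv r.2.1 (killingEquation G d r.1) c.1 c.2.1 x

/-- `δ_k = columns(M_k) - rank(M_k)` at the point `x`. -/
def corank {n : ℕ} (G : Coord n → Matrix (Fin n) (Fin n) ℝ) (d : ℕ) (x : Coord n) (k : ℕ) : ℕ :=
  Fintype.card (JetVar n d k) - (prolongationMatrix G d k x).rank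

/-- The fibre over `x` of `𝓔_d^{(k)} ⊆ J^{k+1}`: the `(k+1)`-jets at `x` solving the `k`-th
prolongation. -/
def prolongationFibre {n : ℕ} (G : Coord n → Matrix (Fin n) (Fin n) ℝ) (d k : ℕ) (x : Coord n) :
    Set (JetVar n d k → ℝ) :=
  {ξ | (prolongationMatrix G d k x).mulVec ξ = 0}

/-- The projection from `(k+2)`-jets to `(k+1)`-jets. -/
def jetProj {n d k : ℕ} (ξ : JetVar n d (k + 1) → ℝ) : JetVar n d k → ℝ :=
  fun v => ξ (v.1, ⟨v.2.1, v.2.2.trans (Nat.le_succ _)⟩)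

/-- The `(k+1)`-jet at `x` of the tuple of functions `(a^I)`. -/
def jetAt {n d : ℕ} (k : ℕ) (a : MultiEq n d → Coord n → ℝ) (x : Coord n) : JetVar n d k → ℝ :=
  fun v => iterOp pd v.2.1 (a v.1) x

/-- The point `x₀` is regular, in the coordinate domain of `φ`: for every `k` the function
`x ↦ rank M_k(x)` attains its maximum over that domain at `x₀`. -/
def IsRegularPoint {n : ℕ} {N : Type*} [TopologicalSpace N] [ChartedSpace (Coord n) N]
    (g : PseudoRiemannianMetric n N) (d : ℕ) (φ : OpenPartialHomeomorph N (Coord n)) (x₀ : N) :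
    Prop :=
  x₀ ∈ φ.source ∧ ∀ k, ∀ x ∈ φ.source,
    (prolongationMatrix (g.inChart φ) d k (φ x)).rank ≤
      (prolongationMatrix (g.inChart φ) d k (φ x₀)).rank

/-! ### The algorithm -/

/-- The condition under which the loop of the algorithm is repeated after the computation of
`δ_k`. -/
def LoopContinues (δ : ℕ → ℕ) (d k : ℕ) : Prop :=
  k ≤ d ∨ (d < k ∧ δ k ≠ δ (k - 1))

/-- Big-step semantics of the loop: `LoopReturns δ d k r` says that the loop, entered with
counter `k`, halts after finitely many iterations and returns `r`. -/
inductive LoopReturns (δ : ℕ → ℕ) (d : ℕ) : ℕ → ℕ × ℕ → Prop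
  | again (k : ℕ) (r : ℕ × ℕ) (hk : LoopContinues δ d k) (hr : LoopReturns δ d (k + 1) r) :
      LoopReturns δ d k r
  | halt (k : ℕ) (hk : ¬ LoopContinues δ d k) : LoopReturns δ d k (δ k, k)

/-- The prolongation-projection algorithm, run in local coordinates with metric matrix `G` at the
point with coordinates `x₀`, halts and returns `r = (δ_k, k)`. -/
def AlgorithmReturns {n : ℕ} (G : Coord n → Matrix (Fin n) (Fin n) ℝ) (d : ℕ) (x₀ : Coord n)
    (r : ℕ × ℕ) : Prop :=
  LoopReturns (corank G d x₀) d 0 r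

end KillingProlongation

end

namespace KillingProlongation

/-! ### Linear differential equations with zero curvature -/

section Frobenius

set_option maxSynthPendingDepth 3

variable {X K : Type*} [NormedAddCommGroup X] [NormedSpace ℝ X] [NormedAddCommGroup K]
  [NormedSpace ℝ K]

/-! The Killing equation is of finite type, and this shows itself at order `d`: for `k ≥ d` a point
of the `k`-th prolongation whose components of order at most `k` vanish is zero
(`IsMetricOn.eq_zero_of_truncL_eq_zero`). Its top components form polynomials `P_α` of degree at
most `d` in the momenta, `|α| = k + 1`, with `∑ i, P_{β + 1_i}(p) (g⁻¹ p)_i = 0` for `|β| = k`.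
Restricted to a line `p + s u` and summed against multinomial weights, these relations equate `s ^
(k + 1)` times a polynomial in `s` with one of degree at most `d`, so both vanish
(`symbol_injective`).

Hence from level `d` on the projections between consecutive solution spaces over `x₀` are injective.
So `δ_k` is nonincreasing there and must repeat, which gives termination; as long as it drops, the
projection is not surjective (`IsMetricOn.corank_succ_le`, `IsMetricOn.exists_not_projection`).

Suppose `δ_{k+1} = δ_k` with `k ≥ d`. Regularity makes the ranks of `M_k` and `M_{k+1}` locally
constant, so near `x₀` the projection `ker M_{k+1} → ker M_k` is an isomorphism of bundles. Its
inverse prescribes all first derivatives of a section of `ker M_k`, that is, a linear connection on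
this bundle. The curvature takes values in `ker M_k` and its lower order part vanishes, so it is
zero by the injectivity above (`FiniteTypeSystem.frameConnection_flat`). Frobenius' theorem, proved
by integrating along rays (`FlatOnBall.exists_solution`), extends each point of `ker M_k(x₀)` to a
parallel section. The parallel sections are the jets of Killing tensors, so germs of Killing tensors
correspond to `ker M_k(x₀)` (`IsMetricOn.finrank_killingGerms`). At higher levels injectivity alone
suffices (`IsMetricOn.exists_killing_of_le`). -/

/-- Global existence on `[0, 1]` for a linear ODE with small coefficients. -/
lemma exists_linear_ode_solution [CompleteSpace K] (A : ℝ → K →L[ℝ] K)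
    (hA : ContinuousOn A (Set.Icc 0 1)) (hb : ∀ t ∈ Set.Icc (0 : ℝ) 1, ‖A t‖ ≤ 1 / 2) (c₀ : K) :
    ∃ y : ℝ → K, y 0 = c₀ ∧
      ∀ t ∈ Set.Icc (0 : ℝ) 1, HasDerivWithinAt y (A t (y t)) (Set.Icc 0 1) t := by
  -- The radius `‖c₀‖` works: in that ball `‖y‖ ≤ 2‖c₀‖`, so the speed is at most `‖c₀‖` and no
  -- solution leaves the ball within time `1`.
  have hP : IsPicardLindelof (fun t y => A t y) (tmin := 0) (tmax := 1) ⟨0, by simp⟩ c₀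
      ‖c₀‖₊ 0 ‖c₀‖₊ 1 := by
    refine ⟨fun t ht => ?_, fun x _ => hA.clm_apply continuousOn_const, fun t ht x hx => ?_, ?_⟩
    · refine LipschitzWith.lipschitzOnWith ((A t).lipschitz.weaken ?_)
      have := hb t ht
      rw [← NNReal.coe_le_coe]
      push_cast
      linarith
    · have h1 : ‖x‖ ≤ 2 * ‖c₀‖ := by
        have h2 : ‖x - c₀‖ ≤ ‖c₀‖ := by simpa [dist_eq_norm] using hx
        have := norm_le_norm_add_norm_sub' x c₀
        linarith
      calc ‖A t x‖ ≤ 1 / 2 * ‖x‖ := (A t).le_of_opNorm_le (hb t ht) x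
        _ ≤ ‖c₀‖ := by linarith
    · simp
  exact hP.exists_eq_forall_mem_Icc_hasDerivWithinAt₀

/-- Grönwall with rate `1` and initial value zero. With `ε = 0` it gives uniqueness, with `ε`
quadratic in the displacement it gives differentiability in the endpoint. -/
lemma norm_le_of_linear_deriv_bound {z z' : ℝ → K} {ε : ℝ}
    (hz : ∀ t ∈ Set.Icc (0 : ℝ) 1, HasDerivWithinAt z (z' t) (Set.Icc 0 1) t) (h0 : z 0 = 0)
    (hb : ∀ t ∈ Set.Icc (0 : ℝ) 1, ‖z' t‖ ≤ ‖z t‖ + ε) : ‖z 1‖ ≤ ε * (Real.exp 1 - 1) := by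
  have := norm_le_gronwallBound_of_norm_deriv_right_le (f := z) (f' := z') (δ := 0) (K := 1)
    (ε := ε) (a := 0) (b := 1) (fun t ht => (hz t ht).continuousWithinAt)
    (fun t ht => ((hz t ⟨ht.1, ht.2.le⟩).mono_of_mem_nhdsWithin (Icc_mem_nhdsGE_of_mem ht)))
    (by simp [h0]) (fun t ht => by simpa using hb t ⟨ht.1, ht.2.le⟩) 1 (by simp)
  rw [gronwallBound_of_K_ne_0 one_ne_zero] at this
  simpa using this

/-- The coefficients of a flat linear connection on a ball, with uniform bounds for the
coefficients and their derivatives. -/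
structure FlatOnBall (B : X → X →L[ℝ] K →L[ℝ] K) (x₀ : X) (r C : ℝ) : Prop where
  differentiableAt : ∀ x ∈ Metric.ball x₀ r, DifferentiableAt ℝ B x
  norm_le : ∀ x ∈ Metric.ball x₀ r, ‖B x‖ ≤ C
  norm_fderiv_le : ∀ x ∈ Metric.ball x₀ r, ‖fderiv ℝ B x‖ ≤ C
  fderiv_lipschitz : ∀ x ∈ Metric.ball x₀ r, ∀ y ∈ Metric.ball x₀ r,
    ‖fderiv ℝ B y - fderiv ℝ B x‖ ≤ C * ‖y - x‖
  -- Each side is a second derivative, in the directions `v`, `w`, that a solution of `Dc(v) = B v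
  -- c` would have; the condition is their symmetry.
  flat : ∀ x ∈ Metric.ball x₀ r, ∀ v w c,
    fderiv ℝ B x v w c + B x w (B x v c) = fderiv ℝ B x w v c + B x v (B x w c)

lemma FlatOnBall.mono {B : X → X →L[ℝ] K →L[ℝ] K} {x₀ : X} {r r' C : ℝ}
    (h : FlatOnBall B x₀ r C) (hr : r' ≤ r) : FlatOnBall B x₀ r' C := by
  have hs := Metric.ball_subset_ball (x := x₀) hr
  exact ⟨fun x hx => h.1 x (hs hx), fun x hx => h.2 x (hs hx), fun x hx => h.3 x (hs hx),
    fun x hx y hy => h.4 x (hs hx) y (hs hy), fun x hx => h.5 x (hs hx)⟩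

/-- Smoothness bounds `B` and `DB` near `x₀` and makes `DB` locally Lipschitz; the sum of the three
bounds is one constant that serves for all of them. -/
lemma exists_flatOnBall {B : X → X →L[ℝ] K →L[ℝ] K} {x₀ : X} {U : Set X} (hU : IsOpen U)
    (hx₀ : x₀ ∈ U) (hB : ContDiffOn ℝ ∞ B U)
    (hflat : ∀ x ∈ U, ∀ v w c,
      fderiv ℝ B x v w c + B x w (B x v c) = fderiv ℝ B x w v c + B x v (B x w c)) :
    ∃ r > 0, ∃ C > 0, Metric.ball x₀ r ⊆ U ∧ FlatOnBall B x₀ r C := by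
  have hBx := hB.contDiffAt (hU.mem_nhds hx₀)
  have hDB : ContDiffAt ℝ 1 (fderiv ℝ B) x₀ :=
    (hBx.fderiv_right (m := 1) (by norm_cast))
  obtain ⟨L, t, ht, hL⟩ := hDB.exists_lipschitzOnWith
  have e1 : ∀ᶠ x in 𝓝 x₀, ‖B x‖ < ‖B x₀‖ + 1 :=
    hBx.continuousAt.norm.eventually_lt continuousAt_const (by simp)
  have e2 : ∀ᶠ x in 𝓝 x₀, ‖fderiv ℝ B x‖ < ‖fderiv ℝ B x₀‖ + 1 :=
    hDB.continuousAt.norm.eventually_lt continuousAt_const (by simp)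
  obtain ⟨r, hr, hball⟩ := Metric.eventually_nhds_iff_ball.1
    (e1.and (e2.and ((hU.eventually_mem hx₀).and (Filter.eventually_mem_set.2 ht))))
  refine ⟨r, hr, (‖B x₀‖ + 1) + (‖fderiv ℝ B x₀‖ + 1) + L, by positivity,
    fun x hx => (hball x hx).2.2.1, ?_⟩
  have p1 := norm_nonneg (B x₀)
  have p2 := norm_nonneg (fderiv ℝ B x₀)
  have p3 := L.coe_nonneg
  refine ⟨fun x hx => ?_, fun x hx => ?_, fun x hx => ?_, fun x hx y hy => ?_,
    fun x hx => hflat x (hball x hx).2.2.1⟩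
  · exact (hB.contDiffAt (hU.mem_nhds (hball x hx).2.2.1)).differentiableAt (by simp)
  · linarith [(hball x hx).1]
  · linarith [(hball x hx).2.1]
  · have := hL.dist_le_mul y (hball y hy).2.2.2 x (hball x hx).2.2.2
    rw [dist_eq_norm, dist_eq_norm] at this
    refine this.trans ?_
    gcongr
    linarith

section

variable {B : X → X →L[ℝ] K →L[ℝ] K} {x₀ : X} {r C : ℝ}

lemma FlatOnBall.norm_sub_le (h : FlatOnBall B x₀ r C) {x y : X} (hx : x ∈ Metric.ball x₀ r)
    (hy : y ∈ Metric.ball x₀ r) : ‖B y - B x‖ ≤ C * ‖y - x‖ :=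
  (convex_ball x₀ r).norm_image_sub_le_of_norm_fderiv_le (𝕜 := ℝ) h.differentiableAt
    h.norm_fderiv_le hx hy

lemma FlatOnBall.norm_taylor_le (h : FlatOnBall B x₀ r C) (hC : 0 ≤ C) {x y : X}
    (hx : x ∈ Metric.ball x₀ r) (hy : y ∈ Metric.ball x₀ r) :
    ‖B y - B x - fderiv ℝ B x (y - x)‖ ≤ C * ‖y - x‖ * ‖y - x‖ := by
  have hs : segment ℝ x y ⊆ Metric.ball x₀ r := (convex_ball x₀ r).segment_subset hx hy
  refine (convex_segment x y).norm_image_sub_le_of_norm_fderiv_le' (𝕜 := ℝ)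
    (fun z hz => h.differentiableAt z (hs hz)) (fun z hz => ?_) (left_mem_segment ℝ x y)
    (right_mem_segment ℝ x y)
  refine (h.fderiv_lipschitz x hx z (hs hz)).trans ?_
  gcongr
  exact norm_sub_le_of_mem_segment hz

lemma add_smul_mem_ball {x₀ v : X} {r : ℝ} (hv : x₀ + v ∈ Metric.ball x₀ r) {t : ℝ}
    (ht : t ∈ Set.Icc (0 : ℝ) 1) : x₀ + t • v ∈ Metric.ball x₀ r := by
  simp only [Metric.mem_ball, dist_self_add_left, norm_smul, Real.norm_eq_abs, abs_of_nonneg ht.1]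
    at hv ⊢
  nlinarith [norm_nonneg v, ht.2, ht.1]

/-- Variation of the solution along rays: the deviation from the linearization is of second
order. -/
lemma FlatOnBall.norm_variation_le (h : FlatOnBall B x₀ r C) (hC : 0 < C) (hCr : C * r ≤ 1 / 2)
    {v w : X} (hv : x₀ + v ∈ Metric.ball x₀ r) (hvw : x₀ + (v + w) ∈ Metric.ball x₀ r)
    {y u : ℝ → K} (h0 : u 0 = y 0)
    (hy : ∀ t ∈ Set.Icc (0 : ℝ) 1,
      HasDerivWithinAt y (B (x₀ + t • v) v (y t)) (Set.Icc 0 1) t)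
    (hu : ∀ t ∈ Set.Icc (0 : ℝ) 1,
      HasDerivWithinAt u (B (x₀ + t • (v + w)) (v + w) (u t)) (Set.Icc 0 1) t)
    {Y : ℝ} (hY : ∀ t ∈ Set.Icc (0 : ℝ) 1, ‖y t‖ ≤ Y) :
    ‖u 1 - y 1 - B (x₀ + v) w (y 1)‖
      ≤ (C * r + C + C * (C * r + C)) * Y * (Real.exp 1 - 1) * ‖w‖ ^ 2 := by
  have hvr : ‖v‖ ≤ r := by simpa using (mem_ball_iff_norm.1 hv).le
  have hvwr : ‖v + w‖ ≤ r := by simpa using (mem_ball_iff_norm.1 hvw).le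
  have hr : 0 ≤ r := (norm_nonneg v).trans hvr
  have hY0 : 0 ≤ Y := (norm_nonneg _).trans (hY 0 (by simp))
  -- The expected first variation of `y` under `v ↦ v + w` is `t • B (x₀ + t • v) w (y t)`. After it
  -- is subtracted, the remainder solves the ODE of `u` with an inhomogeneity `e` that is quadratic
  -- in `w`.
  set z : ℝ → K := fun t => u t - y t - t • B (x₀ + t • v) w (y t) with hz
  set e : ℝ → K := fun t =>
    (B (x₀ + t • (v + w)) v - B (x₀ + t • v) v - fderiv ℝ B (x₀ + t • v) (t • w) v) (y t)
    + (B (x₀ + t • (v + w)) w - B (x₀ + t • v) w) (y t)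
    + t • ((B (x₀ + t • (v + w)) v - B (x₀ + t • v) v) (B (x₀ + t • v) w (y t))
      + B (x₀ + t • (v + w)) w (B (x₀ + t • v) w (y t))) with he
  have hz' : ∀ t ∈ Set.Icc (0 : ℝ) 1, HasDerivWithinAt z
      (B (x₀ + t • (v + w)) (v + w) (z t) + e t) (Set.Icc 0 1) t := by
    intro t ht
    have hm := add_smul_mem_ball hv ht
    have d1 : HasDerivWithinAt (fun t : ℝ => x₀ + t • v) v (Set.Icc 0 1) t := by
      simpa using ((hasDerivAt_id t).smul_const v).const_add x₀ |>.hasDerivWithinAt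
    have d2 : HasDerivWithinAt (fun t : ℝ => B (x₀ + t • v)) (fderiv ℝ B (x₀ + t • v) v)
        (Set.Icc 0 1) t :=
      (h.differentiableAt _ hm).hasFDerivAt.comp_hasDerivWithinAt t d1
    have d3 : HasDerivWithinAt (fun t : ℝ => B (x₀ + t • v) w) (fderiv ℝ B (x₀ + t • v) v w)
        (Set.Icc 0 1) t := by
      simpa using d2.clm_apply (hasDerivWithinAt_const t _ w)
    have d4 := d3.clm_apply (hy t ht)
    have d5 := ((hasDerivWithinAt_id t (Set.Icc (0 : ℝ) 1)).smul d4)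
    have d6 := ((hu t ht).sub (hy t ht)).sub d5
    refine d6.congr_deriv ?_
    -- Flatness exchanges `v` and `w` in the derivative of the expected variation; only then do the
    -- terms linear in `w` cancel.
    have hf := h.flat _ hm v w (y t)
    simp only [hz, he, id, map_sub, map_add, map_smul, add_apply,
      sub_apply, one_smul, smul_apply, hf]
    module
  have hbound : ∀ t ∈ Set.Icc (0 : ℝ) 1, ‖B (x₀ + t • (v + w)) (v + w) (z t) + e t‖
      ≤ ‖z t‖ + (C * r + C + C * (C * r + C)) * Y * ‖w‖ ^ 2 := by
    intro t ht
    have hm := add_smul_mem_ball hv ht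
    have hm' := add_smul_mem_ball hvw ht
    have hd : (x₀ + t • (v + w)) - (x₀ + t • v) = t • w := by rw [smul_add]; abel
    have htw : ‖t • w‖ ≤ ‖w‖ := by
      rw [norm_smul, Real.norm_eq_abs, abs_of_nonneg ht.1]
      nlinarith [norm_nonneg w, ht.2]
    have b1 := h.norm_taylor_le hC.le hm hm'
    have b2 := h.norm_sub_le hm hm'
    rw [hd] at b1 b2
    have b2' : ‖B (x₀ + t • (v + w)) - B (x₀ + t • v)‖ ≤ C * ‖w‖ := b2.trans (by gcongr)
    have n1 : ‖B (x₀ + t • (v + w)) (v + w) (z t)‖ ≤ ‖z t‖ := by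
      have : ‖B (x₀ + t • (v + w)) (v + w)‖ ≤ 1 := by
        calc _ ≤ C * r := ContinuousLinearMap.le_of_opNorm_le_of_le _ (h.norm_le _ hm') hvwr
          _ ≤ 1 := by linarith
      simpa using ContinuousLinearMap.le_of_opNorm_le _ this (z t)
    have n2 : ‖(B (x₀ + t • (v + w)) v - B (x₀ + t • v) v
        - fderiv ℝ B (x₀ + t • v) (t • w) v) (y t)‖ ≤ (C * ‖w‖ * ‖w‖ * r) * Y := by
      have : ‖(B (x₀ + t • (v + w)) - B (x₀ + t • v) - fderiv ℝ B (x₀ + t • v) (t • w)) v‖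
          ≤ C * ‖w‖ * ‖w‖ * r :=
        ContinuousLinearMap.le_of_opNorm_le_of_le _ (b1.trans (by gcongr)) hvr
      exact ContinuousLinearMap.le_of_opNorm_le_of_le _ (by simpa using this) (hY t ht)
    have n3 : ‖(B (x₀ + t • (v + w)) w - B (x₀ + t • v) w) (y t)‖ ≤ (C * ‖w‖ * ‖w‖) * Y := by
      have : ‖(B (x₀ + t • (v + w)) - B (x₀ + t • v)) w‖ ≤ C * ‖w‖ * ‖w‖ :=
        ContinuousLinearMap.le_of_opNorm_le _ b2' w
      exact ContinuousLinearMap.le_of_opNorm_le_of_le _ (by simpa using this) (hY t ht)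
    have nq : ‖B (x₀ + t • v) w (y t)‖ ≤ C * ‖w‖ * Y :=
      ContinuousLinearMap.le_of_opNorm_le_of_le _
        (ContinuousLinearMap.le_of_opNorm_le _ (h.norm_le _ hm) w) (hY t ht)
    have n4 : ‖(B (x₀ + t • (v + w)) v - B (x₀ + t • v) v) (B (x₀ + t • v) w (y t))‖
        ≤ (C * ‖w‖ * r) * (C * ‖w‖ * Y) := by
      have : ‖(B (x₀ + t • (v + w)) - B (x₀ + t • v)) v‖ ≤ C * ‖w‖ * r :=
        ContinuousLinearMap.le_of_opNorm_le_of_le _ b2' hvr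
      exact ContinuousLinearMap.le_of_opNorm_le_of_le _ (by simpa using this) nq
    have n5 : ‖B (x₀ + t • (v + w)) w (B (x₀ + t • v) w (y t))‖
        ≤ (C * ‖w‖) * (C * ‖w‖ * Y) :=
      ContinuousLinearMap.le_of_opNorm_le_of_le _
        (ContinuousLinearMap.le_of_opNorm_le _ (h.norm_le _ hm') w) nq
    have n6 : ‖e t‖ ≤ (C * ‖w‖ * ‖w‖ * r) * Y + (C * ‖w‖ * ‖w‖) * Y
        + ((C * ‖w‖ * r) * (C * ‖w‖ * Y) + (C * ‖w‖) * (C * ‖w‖ * Y)) := by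
      refine (norm_add_le _ _).trans (add_le_add ((norm_add_le _ _).trans (add_le_add n2 n3)) ?_)
      rw [norm_smul, Real.norm_eq_abs, abs_of_nonneg ht.1]
      refine (mul_le_of_le_one_left (norm_nonneg _) ht.2).trans ?_
      exact (norm_add_le _ _).trans (add_le_add n4 n5)
    refine (norm_add_le _ _).trans (add_le_add n1 (n6.trans (le_of_eq ?_)))
    ring
  have := norm_le_of_linear_deriv_bound hz' (by simp [hz, h0]) hbound
  simp only [hz, one_smul] at this
  refine this.trans (le_of_eq ?_)
  ring

/-- **Frobenius' theorem** for flat linear connections. -/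
theorem FlatOnBall.exists_solution [CompleteSpace K] (h : FlatOnBall B x₀ r C) (hr : 0 < r)
    (hC : 0 < C) (hCr : C * r ≤ 1 / 2) (c₀ : K) :
    ∃ c : X → K, c x₀ = c₀ ∧
      ∀ x ∈ Metric.ball x₀ r, HasFDerivAt c ((B x).flip (c x)) x := by
  have hex : ∀ v : X, ∃ y : ℝ → K, x₀ + v ∈ Metric.ball x₀ r → y 0 = c₀ ∧
      ∀ t ∈ Set.Icc (0 : ℝ) 1, HasDerivWithinAt y (B (x₀ + t • v) v (y t)) (Set.Icc 0 1) t := by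
    intro v
    by_cases hv : x₀ + v ∈ Metric.ball x₀ r
    · have hvr : ‖v‖ ≤ r := by simpa using (mem_ball_iff_norm.1 hv).le
      obtain ⟨y, hy⟩ := exists_linear_ode_solution (fun t => B (x₀ + t • v) v) (fun t ht => by
          have h1 := (h.differentiableAt _ (add_smul_mem_ball hv ht)).continuousAt
          have h2 : ContinuousAt (fun t : ℝ => x₀ + t • v) t := by fun_prop
          exact ((ContinuousAt.comp (f := fun t : ℝ => x₀ + t • v) h1 h2).clm_apply
            continuousAt_const).continuousWithinAt)
        (fun t ht => (ContinuousLinearMap.le_of_opNorm_le_of_le _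
          (h.norm_le _ (add_smul_mem_ball hv ht)) hvr).trans hCr) c₀
      exact ⟨y, fun _ => hy⟩
    · exact ⟨0, fun h => absurd h hv⟩
  choose y hy using hex
  -- The solution at `x` is the value at time `1` of parallel transport along the ray from `x₀` to
  -- `x`. Its derivative in radial and transversal directions alike comes from `norm_variation_le`.
  refine ⟨fun x => y (x - x₀) 1, ?_, fun x hx => ?_⟩
  · have h0 : x₀ + (0 : X) ∈ Metric.ball x₀ r := by simpa using hr
    have h1 := hy 0 h0
    have := norm_le_of_linear_deriv_bound (z := fun t => y 0 t - c₀) (z' := fun _ => 0) (ε := 0)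
      (fun t ht => by simpa using (h1.2 t ht).sub_const c₀) (by simp [h1.1])
      (fun t _ => by simp)
    simpa [sub_eq_zero] using this
  · set v := x - x₀ with hv
    have hxv : x = x₀ + v := by simp [hv]
    have hvb : x₀ + v ∈ Metric.ball x₀ r := hxv ▸ hx
    have h1 := hy v hvb
    obtain ⟨Y, hY⟩ := (isCompact_Icc (a := (0 : ℝ)) (b := 1)).exists_bound_of_continuousOn
      (f := y v) (fun t ht => (h1.2 t ht).continuousWithinAt)
    rw [hasFDerivAt_iff_isLittleO_nhds_zero]
    refine Asymptotics.IsBigO.trans_isLittleO (g := fun w : X => ‖w‖ ^ 2) ?_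
      (Asymptotics.isLittleO_norm_pow_id one_lt_two)
    refine Asymptotics.IsBigO.of_bound
      ((C * r + C + C * (C * r + C)) * Y * (Real.exp 1 - 1)) ?_
    have hev : ∀ᶠ w in 𝓝 (0 : X), x₀ + (v + w) ∈ Metric.ball x₀ r := by
      have hc : ContinuousAt (fun w : X => x₀ + (v + w)) 0 := by fun_prop
      exact hc.eventually_mem (Metric.isOpen_ball.mem_nhds (by simpa using hvb))
    filter_upwards [hev] with w hw
    have h2 := hy (v + w) hw
    have := h.norm_variation_le hC hCr hvb hw (h2.1.trans h1.1.symm) h1.2 h2.2 hY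
    have e1 : x + w - x₀ = v + w := by rw [hv]; abel
    simpa [e1, ← hv, ← hxv] using this

/-- Along each ray from `x₀` a solution satisfies a linear ODE with zero initial value. -/
lemma FlatOnBall.solution_unique (h : FlatOnBall B x₀ r C) (hCr : C * r ≤ 1 / 2)
    {c : X → K} (h0 : c x₀ = 0)
    (hc : ∀ x ∈ Metric.ball x₀ r, HasFDerivAt c ((B x).flip (c x)) x) :
    ∀ x ∈ Metric.ball x₀ r, c x = 0 := by
  intro x hx
  obtain ⟨v, rfl⟩ : ∃ v, x = x₀ + v := ⟨x - x₀, by simp⟩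
  have hvr : ‖v‖ ≤ r := by simpa using (mem_ball_iff_norm.1 hx).le
  have := norm_le_of_linear_deriv_bound (z := fun t : ℝ => c (x₀ + t • v))
    (z' := fun t => B (x₀ + t • v) v (c (x₀ + t • v))) (ε := 0) (fun t ht => ?_) (by simpa using h0)
    (fun t ht => ?_)
  · simpa using this
  · have d1 : HasDerivWithinAt (fun t : ℝ => x₀ + t • v) v (Set.Icc 0 1) t := by
      simpa using ((hasDerivAt_id t).smul_const v).const_add x₀ |>.hasDerivWithinAt
    exact (hc _ (add_smul_mem_ball hx ht)).comp_hasDerivWithinAt t d1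
  · have : ‖B (x₀ + t • v) v‖ ≤ 1 :=
      (ContinuousLinearMap.le_of_opNorm_le_of_le _
        (h.norm_le _ (add_smul_mem_ball hx ht)) hvr).trans (by linarith)
    simpa using ContinuousLinearMap.le_of_opNorm_le _ this (c (x₀ + t • v))

/-- Bootstrapping: the derivative of `c` is a smooth expression in `c`, so each order of smoothness
of `c` yields the next. -/
lemma contDiffOn_of_hasFDerivAt_flip {U : Set X} (hU : IsOpen U) (hB : ContDiffOn ℝ ∞ B U)
    {c : X → K} (hc : ∀ x ∈ U, HasFDerivAt c ((B x).flip (c x)) x) : ContDiffOn ℝ ∞ c U := by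
  rw [contDiffOn_infty]
  intro m
  induction m with
  | zero => exact contDiffOn_zero.2 fun x hx => (hc x hx).continuousAt.continuousWithinAt
  | succ m ih =>
    have := (contDiffOn_succ_iff_fderiv_of_isOpen (𝕜 := ℝ) (f := c) (n := m) hU).2
      ⟨fun x hx => (hc x hx).differentiableAt.differentiableWithinAt, by simp, ?_⟩
    · exact_mod_cast this
    · have h1 : ContDiffOn ℝ m (fun x => (B x).flip (c x)) U := by
        have hf : ContDiffOn ℝ m (fun x => (B x).flip) U :=
          (ContinuousLinearMap.flipₗᵢ ℝ X K K).contDiff.comp_contDiffOn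
            (hB.of_le (WithTop.coe_le_coe.2 le_top))
        exact hf.clm_apply ih
      exact h1.congr fun x hx => (hc x hx).fderiv

end

end Frobenius

/-! ### Linear systems of finite type -/

section FiniteType

set_option maxSynthPendingDepth 3
set_option linter.unusedSectionVars false

variable {X E₁ E₀ E' F₁ F₀ : Type*}
  [NormedAddCommGroup X] [NormedSpace ℝ X]
  [NormedAddCommGroup E₁] [NormedSpace ℝ E₁] [FiniteDimensional ℝ E₁]
  [NormedAddCommGroup E₀] [NormedSpace ℝ E₀] [FiniteDimensional ℝ E₀]
  [NormedAddCommGroup E'] [NormedSpace ℝ E']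
  [NormedAddCommGroup F₁] [NormedSpace ℝ F₁] [FiniteDimensional ℝ F₁]
  [NormedAddCommGroup F₀] [NormedSpace ℝ F₀]

/-- A linear system `M₀ s = 0` on jets `s ∈ E₀` together with its first prolongation `M₁ ξ = 0`
on jets `ξ ∈ E₁` of one order more. The maps `pr` and `sh v` send the jet of a function to the jets
of lower order of the function and of its derivative along `v`; `π` and `sh'` are their analogues
one order below. Both systems have vanishing symbol and the same constant solution dimension. -/
structure FiniteTypeSystem (U : Set X) (M₁ : X → E₁ →L[ℝ] F₁) (M₀ : X → E₀ →L[ℝ] F₀)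
    (pr : E₁ →L[ℝ] E₀) (sh : X →L[ℝ] E₁ →L[ℝ] E₀) (π : E₀ →L[ℝ] E') (sh' : X →L[ℝ] E₀ →L[ℝ] E')
    (r : ℕ) : Prop where
  isOpen : IsOpen U
  smooth₁ : ContDiffOn ℝ ∞ M₁ U
  smooth₀ : ContDiffOn ℝ ∞ M₀ U
  pr_mem : ∀ x ∈ U, ∀ ξ, M₁ x ξ = 0 → M₀ x (pr ξ) = 0
  pr_inj : ∀ x ∈ U, ∀ ξ, M₁ x ξ = 0 → pr ξ = 0 → ξ = 0
  π_inj : ∀ x ∈ U, ∀ s, M₀ x s = 0 → π s = 0 → s = 0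
  -- This is `M₀ s = 0` differentiated along `v`, with `sh v ξ` in the place of the derivative of
  -- `s`.
  tangent : ∀ x ∈ U, ∀ ξ, M₁ x ξ = 0 → ∀ v, M₀ x (sh v ξ) + fderiv ℝ M₀ x v (pr ξ) = 0
  π_sh : ∀ v ξ, π (sh v ξ) = sh' v (pr ξ)
  sh_comm : ∀ v w ξ, sh' w (sh v ξ) = sh' v (sh w ξ)
  finrank₁ : ∀ x ∈ U, Module.finrank ℝ (M₁ x).ker = r
  finrank₀ : ∀ x ∈ U, Module.finrank ℝ (M₀ x).ker = r

variable {U : Set X} {M₁ : X → E₁ →L[ℝ] F₁} {M₀ : X → E₀ →L[ℝ] F₀} {pr : E₁ →L[ℝ] E₀}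
  {sh : X →L[ℝ] E₁ →L[ℝ] E₀} {π : E₀ →L[ℝ] E'} {sh' : X →L[ℝ] E₀ →L[ℝ] E'} {r : ℕ}

/-- A smooth frame, over `W` and with model space `K`, of the solution bundle of `M₁`, normalized
by `l`. -/
structure SolutionFrame {K : Type*} [NormedAddCommGroup K] [NormedSpace ℝ K]
    (W : Set X) (M₁ : X → E₁ →L[ℝ] F₁) (pr : E₁ →L[ℝ] E₀) (l : E₀ →L[ℝ] K)
    (ι : X → K →L[ℝ] E₁) : Prop where
  isOpen : IsOpen W
  smooth : ContDiffOn ℝ ∞ ι W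
  mem : ∀ x ∈ W, ∀ k, M₁ x (ι x k) = 0
  left_inv : ∀ x ∈ W, ∀ k, l (pr (ι x k)) = k

/-- Let `l` and `L` project onto `ker M₀(x₀)` and `range M₁(x₀)`. Equality of the two kernel
dimensions makes `Φ x = (l ∘ pr, L ∘ M₁ x)` an isomorphism at `x₀`, hence nearby, and the frame is
`k ↦ (Φ x)⁻¹ (k, 0)`. -/
lemma FiniteTypeSystem.exists_frame (h : FiniteTypeSystem U M₁ M₀ pr sh π sh' r) {x₀ : X}
    (hx₀ : x₀ ∈ U) : ∃ (l : E₀ →L[ℝ] (M₀ x₀).ker) (W : Set X) (ι : X → (M₀ x₀).ker →L[ℝ] E₁),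
      x₀ ∈ W ∧ W ⊆ U ∧ SolutionFrame W M₁ pr l ι := by
  obtain ⟨l', hl'⟩ := LinearMap.exists_leftInverse_of_injective ((M₀ x₀).ker.subtype)
    (Submodule.ker_subtype _)
  obtain ⟨L', hL'⟩ := LinearMap.exists_leftInverse_of_injective ((M₁ x₀).range.subtype)
    (Submodule.ker_subtype _)
  set l : E₀ →L[ℝ] (M₀ x₀).ker := LinearMap.toContinuousLinearMap l' with hl
  set L : F₁ →L[ℝ] (M₁ x₀).range := LinearMap.toContinuousLinearMap L' with hL
  have hl1 : ∀ k : (M₀ x₀).ker, l k = k := fun k => LinearMap.congr_fun hl' k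
  have hL1 : ∀ k : (M₁ x₀).range, L k = k := fun k => LinearMap.congr_fun hL' k
  set Φ : X → E₁ →L[ℝ] (M₀ x₀).ker × (M₁ x₀).range :=
    fun x => (l ∘L pr).prod (L ∘L M₁ x) with hΦ
  have hΦinj : Function.Injective (Φ x₀) := by
    rw [injective_iff_map_eq_zero]
    intro ξ hξ
    have h1 : l (pr ξ) = 0 := congrArg Prod.fst hξ
    have h2 : L (M₁ x₀ ξ) = 0 := congrArg Prod.snd hξ
    have h3 := hL1 ⟨M₁ x₀ ξ, ⟨ξ, rfl⟩⟩
    have h4 : M₁ x₀ ξ = 0 := by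
      have : (⟨M₁ x₀ ξ, ⟨ξ, rfl⟩⟩ : (M₁ x₀).range) = 0 := h3.symm.trans h2
      exact congrArg Subtype.val this
    have h5 := hl1 ⟨pr ξ, h.pr_mem x₀ hx₀ ξ h4⟩
    have h6 : pr ξ = 0 := by
      have : (⟨pr ξ, h.pr_mem x₀ hx₀ ξ h4⟩ : (M₀ x₀).ker) = 0 := h5.symm.trans h1
      exact congrArg Subtype.val this
    exact h.pr_inj x₀ hx₀ ξ h4 h6
  have hrn := (M₁ x₀ : E₁ →ₗ[ℝ] F₁).finrank_range_add_finrank_ker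
  have hdim : Module.finrank ℝ E₁ = Module.finrank ℝ ((M₀ x₀).ker × (M₁ x₀).range) := by
    rw [Module.finrank_prod, h.finrank₀ x₀ hx₀, ← h.finrank₁ x₀ hx₀, add_comm]
    exact hrn.symm
  let e : E₁ ≃L[ℝ] (M₀ x₀).ker × (M₁ x₀).range :=
    (LinearEquiv.ofInjectiveOfFinrankEq (Φ x₀ : E₁ →ₗ[ℝ] _) hΦinj hdim).toContinuousLinearEquiv
  have he : (e : E₁ →L[ℝ] (M₀ x₀).ker × (M₁ x₀).range) = Φ x₀ := by
    ext1 ξ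
    rfl
  have hΦs : ContDiffOn ℝ ∞ Φ U :=
    ((contDiffOn_const (c := ContinuousLinearMap.inl ℝ _ (M₁ x₀).range ∘L l ∘L pr)).add
      ((contDiffOn_const (c := ContinuousLinearMap.inr ℝ (M₀ x₀).ker _ ∘L L)).clm_comp h.smooth₁)).congr
      fun x _ => by ext1 ξ; simp [hΦ]
  have hev : ∀ᶠ x in 𝓝 x₀, Φ x ∈ Set.range
      ((↑) : (E₁ ≃L[ℝ] (M₀ x₀).ker × (M₁ x₀).range) → (E₁ →L[ℝ] (M₀ x₀).ker × (M₁ x₀).range)) := by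
    have hc := (hΦs.contDiffAt (h.isOpen.mem_nhds hx₀)).continuousAt
    refine hc.eventually_mem ?_
    rw [← he]
    exact e.nhds
  obtain ⟨W, hW, hWo, hxW⟩ := eventually_nhds_iff.1 (hev.and (h.isOpen.eventually_mem hx₀))
  refine ⟨l, W, fun x => (Φ x).inverse ∘L ContinuousLinearMap.inl ℝ _ _, hxW, fun x hx => (hW x hx).2,
    hWo, fun x hx => ?_, fun x hx k => ?_, fun x hx k => ?_⟩
  · obtain ⟨⟨e', he'⟩, hxU⟩ := hW x hx
    have h1 := hΦs.contDiffAt (h.isOpen.mem_nhds hxU)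
    have h2 : ContDiffAt ℝ ∞ ContinuousLinearMap.inverse (Φ x) := he' ▸ contDiffAt_map_inverse e'
    exact ((h2.comp x h1).clm_comp contDiffAt_const).contDiffWithinAt
  · obtain ⟨⟨e', he'⟩, hxU⟩ := hW x hx
    have h1 : Φ x ((Φ x).inverse (k, 0)) = (k, 0) := by
      rw [← he', ContinuousLinearMap.inverse_equiv]
      exact e'.apply_symm_apply _
    have h2 : L (M₁ x ((Φ x).inverse (k, 0))) = 0 := congrArg Prod.snd h1
    have hsurj : ((L ∘L M₁ x : E₁ →L[ℝ] (M₁ x₀).range) : E₁ →ₗ[ℝ] (M₁ x₀).range).range = ⊤ := by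
      refine LinearMap.range_eq_top.2 fun q => ?_
      obtain ⟨ξ, hξ⟩ := e'.surjective (0, q)
      have : Φ x ξ = (0, q) := by rw [← he']; exact hξ
      exact ⟨ξ, congrArg Prod.snd this⟩
    have hle : (M₁ x : E₁ →ₗ[ℝ] F₁).ker ≤ ((L ∘L M₁ x : E₁ →L[ℝ] (M₁ x₀).range) : E₁ →ₗ[ℝ] (M₁ x₀).range).ker := by
      intro ξ hξ
      have hξ' : M₁ x ξ = 0 := hξ
      simp [hξ']
    -- A priori the frame is killed only by `L ∘ M₁ x`. This map has the rank of `M₁ x₀`, so the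
    -- constant kernel dimension of `M₁` forces its kernel to be that of `M₁ x`.
    have heq := Submodule.eq_of_le_of_finrank_eq hle (by
      have h3 := ((L ∘L M₁ x : E₁ →L[ℝ] (M₁ x₀).range) : E₁ →ₗ[ℝ] (M₁ x₀).range).finrank_range_add_finrank_ker
      rw [hsurj, finrank_top, ← hrn] at h3
      have h4 := h.finrank₁ x hxU
      have h5 := h.finrank₁ x₀ hx₀
      omega)
    have : (Φ x).inverse (k, 0) ∈ (M₁ x : E₁ →ₗ[ℝ] F₁).ker := by
      rw [heq]
      exact h2
    exact this
  · obtain ⟨⟨e', he'⟩, hxU⟩ := hW x hx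
    have h1 : Φ x ((Φ x).inverse (k, 0)) = (k, 0) := by
      rw [← he', ContinuousLinearMap.inverse_equiv]
      exact e'.apply_symm_apply _
    exact congrArg Prod.fst h1

section

/-! ### The connection on the solution bundle and its curvature. -/

variable {K : Type*} [NormedAddCommGroup K] [NormedSpace ℝ K] {W : Set X} {l : E₀ →L[ℝ] K}
  {ι : X → K →L[ℝ] E₁}

/-- The map `pr ∘ ι x` is injective from a space of dimension `r` into `ker M₀ x`, which also has
dimension `r`; so it is onto, with inverse `l`. -/
lemma FiniteTypeSystem.eq_frame₀ (h : FiniteTypeSystem U M₁ M₀ pr sh π sh' r)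
    (hK : Module.finrank ℝ K = r) (hf : SolutionFrame W M₁ pr l ι) (hWU : W ⊆ U) {x : X}
    (hx : x ∈ W) {s : E₀} (hs : M₀ x s = 0) : pr (ι x (l s)) = s := by
  have hinj : Function.Injective ((pr ∘L ι x : K →L[ℝ] E₀) : K →ₗ[ℝ] E₀) :=
    Function.LeftInverse.injective (g := l) (hf.left_inv x hx)
  have hle : ((pr ∘L ι x : K →L[ℝ] E₀) : K →ₗ[ℝ] E₀).range ≤ (M₀ x : E₀ →ₗ[ℝ] F₀).ker := by
    rintro _ ⟨k, rfl⟩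
    exact h.pr_mem x (hWU hx) _ (hf.mem x hx k)
  have heq := Submodule.eq_of_le_of_finrank_eq hle (by
    rw [LinearMap.finrank_range_of_inj hinj, hK]
    exact (h.finrank₀ x (hWU hx)).symm)
  obtain ⟨k, rfl⟩ : s ∈ ((pr ∘L ι x : K →L[ℝ] E₀) : K →ₗ[ℝ] E₀).range := by
    rw [heq]
    exact hs
  exact congrArg (fun k => pr (ι x k)) (hf.left_inv x hx k)

lemma FiniteTypeSystem.eq_of_frame (h : FiniteTypeSystem U M₁ M₀ pr sh π sh' r)
    (hK : Module.finrank ℝ K = r) (hf : SolutionFrame W M₁ pr l ι) (hWU : W ⊆ U) {x : X}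
    (hx : x ∈ W) {s : E₀} (hs : M₀ x s = 0) (hl : l s = 0) : s = 0 := by
  rw [← h.eq_frame₀ hK hf hWU hx hs, hl]
  simp

lemma FiniteTypeSystem.eq_frame₁ (h : FiniteTypeSystem U M₁ M₀ pr sh π sh' r)
    (hK : Module.finrank ℝ K = r) (hf : SolutionFrame W M₁ pr l ι) (hWU : W ⊆ U) {x : X}
    (hx : x ∈ W) {ξ : E₁} (hξ : M₁ x ξ = 0) : ι x (l (pr ξ)) = ξ := by
  have h1 := h.eq_frame₀ hK hf hWU hx (h.pr_mem x (hWU hx) ξ hξ)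
  refine sub_eq_zero.1 (h.pr_inj x (hWU hx) _ ?_ ?_)
  · rw [map_sub, hf.mem x hx, hξ, sub_zero]
  · rw [map_sub, h1, sub_self]

/-- The connection on the solution bundle, expressed in a frame. -/
noncomputable def frameConnection (sh : X →L[ℝ] E₁ →L[ℝ] E₀) (l : E₀ →L[ℝ] K)
    (ι : X → K →L[ℝ] E₁) (x : X) : X →L[ℝ] K →L[ℝ] K :=
  (ContinuousLinearMap.compL ℝ K E₀ K l) ∘L (((ContinuousLinearMap.compL ℝ K E₁ E₀).flip (ι x)) ∘L sh)

@[simp]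
lemma frameConnection_apply (x v : X) (k : K) :
    frameConnection sh l ι x v k = l (sh v (ι x k)) := rfl

lemma SolutionFrame.contDiffOn_frameConnection (hf : SolutionFrame W M₁ pr l ι) :
    ContDiffOn ℝ ∞ (frameConnection sh l ι) W := by
  unfold frameConnection
  exact contDiffOn_const.clm_comp
    (((ContinuousLinearMap.compL ℝ K E₁ E₀).flip.contDiff.comp_contDiffOn hf.smooth).clm_comp
      contDiffOn_const)

/-- The hypothesis controls only the `l`-component of the derivative of `s = pr (ι c)`. The
difference between this derivative and `sh v ξ` lies in `ker M₀`, since both satisfy the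
differentiated equation, and there `l` is injective. -/
lemma FiniteTypeSystem.hasFDerivAt_of_frame (h : FiniteTypeSystem U M₁ M₀ pr sh π sh' r)
    (hK : Module.finrank ℝ K = r) (hf : SolutionFrame W M₁ pr l ι) (hWU : W ⊆ U) {x : X}
    (hx : x ∈ W) {c : X → K} (hc : HasFDerivAt c ((frameConnection sh l ι x).flip (c x)) x) :
    HasFDerivAt (fun y => pr (ι y (c y))) (sh.flip (ι x (c x))) x := by
  have hι : HasFDerivAt ι (fderiv ℝ ι x) x :=
    ((hf.smooth.contDiffAt (hf.isOpen.mem_nhds hx)).differentiableAt (by simp)).hasFDerivAt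
  have hM : HasFDerivAt M₀ (fderiv ℝ M₀ x) x :=
    ((h.smooth₀.contDiffAt (h.isOpen.mem_nhds (hWU hx))).differentiableAt (by simp)).hasFDerivAt
  have hs := pr.hasFDerivAt.comp x (hι.clm_apply hc)
  refine hs.congr_fderiv ?_
  set s' := pr ∘L ((ι x) ∘L ((frameConnection sh l ι x).flip (c x)) + (fderiv ℝ ι x).flip (c x))
    with hs'
  have hzero : ∀ᶠ y in 𝓝 x, M₀ y (pr (ι y (c y))) = 0 := by
    filter_upwards [hf.isOpen.eventually_mem hx] with y hy
    exact h.pr_mem y (hWU hy) _ (hf.mem y hy _)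
  have hone : ∀ᶠ y in 𝓝 x, l (pr (ι y (c y))) = c y := by
    filter_upwards [hf.isOpen.eventually_mem hx] with y hy
    exact hf.left_inv y hy _
  have d1 := (hM.clm_apply hs).unique ((hasFDerivAt_const (0 : F₀) x).congr_of_eventuallyEq hzero)
  have d2 := (l.hasFDerivAt.comp x hs).unique (hc.congr_of_eventuallyEq hone)
  ext1 v
  have d1v := congrArg (fun A => A v) d1
  have d2v := congrArg (fun A => A v) d2
  have ht := h.tangent x (hWU hx) _ (hf.mem x hx (c x)) v
  refine sub_eq_zero.1 (h.eq_of_frame hK hf hWU hx ?_ ?_)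
  · rw [map_sub, ContinuousLinearMap.flip_apply, eq_neg_of_add_eq_zero_left ht, sub_neg_eq_add]
    exact d1v
  · rw [map_sub, sub_eq_zero]
    exact d2v

/-- With `ξ'` the derivative of the lifted section, the curvature is `l` of `sh w (ξ' v) - sh v (ξ'
w)`. Differentiating `tangent` and using the symmetry of `D²M₀` puts this difference in `ker M₀`;
`π` kills it because shifts commute one order below; then `π_inj` applies. -/
lemma FiniteTypeSystem.frameConnection_flat (h : FiniteTypeSystem U M₁ M₀ pr sh π sh' r)
    (hK : Module.finrank ℝ K = r) (hf : SolutionFrame W M₁ pr l ι) (hWU : W ⊆ U) {x : X}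
    (hx : x ∈ W) (v w : X) (k : K) :
    fderiv ℝ (frameConnection sh l ι) x v w k
        + frameConnection sh l ι x w (frameConnection sh l ι x v k)
      = fderiv ℝ (frameConnection sh l ι) x w v k
        + frameConnection sh l ι x v (frameConnection sh l ι x w k) := by
  set B := frameConnection sh l ι with hB
  have hι : HasFDerivAt ι (fderiv ℝ ι x) x :=
    ((hf.smooth.contDiffAt (hf.isOpen.mem_nhds hx)).differentiableAt (by simp)).hasFDerivAt
  have hM0 := h.smooth₀.contDiffAt (h.isOpen.mem_nhds (hWU hx))
  have hM : HasFDerivAt M₀ (fderiv ℝ M₀ x) x := (hM0.differentiableAt (by simp)).hasFDerivAt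
  have hDM : HasFDerivAt (fderiv ℝ M₀) (fderiv ℝ (fderiv ℝ M₀) x) x :=
    ((hM0.fderiv_right (m := 1) (by norm_cast)).differentiableAt (by simp)).hasFDerivAt
  have hsymm : IsSymmSndFDerivAt ℝ M₀ x :=
    hM0.isSymmSndFDerivAt (by
      rw [minSmoothness_of_isRCLikeNormedField]
      exact WithTop.coe_le_coe.2 le_top)
  have hBd : HasFDerivAt B (fderiv ℝ B x) x :=
    ((hf.contDiffOn_frameConnection.contDiffAt (hf.isOpen.mem_nhds hx)).differentiableAt
      (by simp)).hasFDerivAt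
  -- A section that is parallel at the single point `x` suffices, so an affine one will do and no
  -- solution need be known yet.
  set c : X → K := fun y => k + B x (y - x) k with hcdef
  have hcx : c x = k := by simp [hcdef]
  have hc : HasFDerivAt c ((B x).flip (c x)) x := by
    rw [hcx]
    have h1 : HasFDerivAt (fun y => (B x).flip k (y - x)) ((B x).flip k) x := by
      have := ((B x).flip k).hasFDerivAt.comp x ((hasFDerivAt_id x).sub_const x)
      rwa [ContinuousLinearMap.comp_id] at this
    exact h1.const_add k
  have hξ := hι.clm_apply hc
  set ξ : X → E₁ := fun y => ι y (c y) with hξdef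
  set ξ' := (ι x) ∘L ((B x).flip (c x)) + (fderiv ℝ ι x).flip (c x) with hξ'
  have hs := h.hasFDerivAt_of_frame hK hf hWU hx hc
  have hprξ : ∀ u, pr (ξ' u) = sh u (ξ x) := fun u =>
    congrArg (fun A => A u) ((pr.hasFDerivAt.comp x hξ).unique hs)
  have key : ∀ v w, fderiv ℝ B x v w k + B x w (B x v k) = l (sh w (ξ' v)) := by
    intro v w
    have d1 := ((hBd.clm_apply (hasFDerivAt_const w x)).clm_apply hc)
    have d2 : HasFDerivAt (fun y => B y w (c y)) (l ∘L sh w ∘L ξ') x :=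
      (l ∘L sh w).hasFDerivAt.comp x hξ
    have := congrArg (fun A => A v) (d1.unique d2)
    simp only [hcx] at this
    simpa [add_comm] using this
  have hM' : ∀ v w, fderiv ℝ M₀ x v (sh w (ξ x)) + M₀ x (sh w (ξ' v))
      + (fderiv ℝ (fderiv ℝ M₀) x v w (pr (ξ x)) + fderiv ℝ M₀ x w (sh v (ξ x))) = 0 := by
    intro v w
    have hz : ∀ᶠ y in 𝓝 x, M₀ y (sh w (ξ y)) + fderiv ℝ M₀ y w (pr (ξ y)) = 0 := by
      filter_upwards [hf.isOpen.eventually_mem hx] with y hy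
      exact h.tangent y (hWU hy) _ (hf.mem y hy _) w
    have d1 := (hM.clm_apply ((sh w).hasFDerivAt.comp x hξ)).add
      ((hDM.clm_apply (hasFDerivAt_const w x)).clm_apply hs)
    have := congrArg (fun A => A v)
      (d1.unique ((hasFDerivAt_const (0 : F₀) x).congr_of_eventuallyEq hz))
    simp at this
    rw [← this]
    abel
  rw [key v w, key w v]
  congr 1
  refine sub_eq_zero.1 (h.π_inj x (hWU hx) _ ?_ ?_)
  · have a1 := hM' v w
    have a2 := hM' w v
    rw [hsymm v w] at a1
    rw [map_sub]
    have := a1.trans a2.symm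
    have e : M₀ x (sh w (ξ' v)) - M₀ x (sh v (ξ' w))
        = (fderiv ℝ M₀ x v (sh w (ξ x)) + M₀ x (sh w (ξ' v))
          + (fderiv ℝ (fderiv ℝ M₀) x w v (pr (ξ x)) + fderiv ℝ M₀ x w (sh v (ξ x))))
          - (fderiv ℝ M₀ x w (sh v (ξ x)) + M₀ x (sh v (ξ' w))
          + (fderiv ℝ (fderiv ℝ M₀) x w v (pr (ξ x)) + fderiv ℝ M₀ x v (sh w (ξ x)))) := by abel
    rw [e, this, sub_self]
  · rw [map_sub, h.π_sh, h.π_sh, hprξ, hprξ, h.sh_comm, sub_self]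

end

/-- Every solution of `M₀` at `x₀` extends to a local solution of the differential system. -/
theorem FiniteTypeSystem.exists_solution (h : FiniteTypeSystem U M₁ M₀ pr sh π sh' r) {x₀ : X}
    (hx₀ : x₀ ∈ U) {s₀ : E₀} (hs₀ : M₀ x₀ s₀ = 0) : ∃ (W : Set X) (ξ : X → E₁), IsOpen W ∧ x₀ ∈ W ∧
      W ⊆ U ∧ ContDiffOn ℝ ∞ ξ W ∧ pr (ξ x₀) = s₀ ∧
      ∀ x ∈ W, M₁ x (ξ x) = 0 ∧ HasFDerivAt (fun y => pr (ξ y)) (sh.flip (ξ x)) x := by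
  obtain ⟨l, W, ι, hxW, hWU, hf⟩ := h.exists_frame hx₀
  have hK := h.finrank₀ x₀ hx₀
  obtain ⟨ρ, hρ, C, hC, hsub, hflat⟩ := exists_flatOnBall hf.isOpen hxW
    (hf.contDiffOn_frameConnection (sh := sh))
    (fun x hx v w k => h.frameConnection_flat hK hf hWU hx v w k)
  set ρ' := min ρ (1 / (2 * C)) with hρ'
  have hρ'0 : 0 < ρ' := by positivity
  have hCr : C * ρ' ≤ 1 / 2 := by
    calc C * ρ' ≤ C * (1 / (2 * C)) := by gcongr; exact min_le_right _ _
      _ = 1 / 2 := by field_simp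
  have hsub' : Metric.ball x₀ ρ' ⊆ W :=
    (Metric.ball_subset_ball (min_le_left _ _)).trans hsub
  obtain ⟨c, hc0, hc⟩ := (hflat.mono (min_le_left _ _)).exists_solution hρ'0 hC hCr (l s₀)
  refine ⟨Metric.ball x₀ ρ', fun y => ι y (c y), Metric.isOpen_ball, Metric.mem_ball_self hρ'0,
    hsub'.trans hWU, ?_, ?_, fun x hx => ⟨hf.mem x (hsub' hx) _, ?_⟩⟩
  · exact (hf.smooth.mono hsub').clm_apply (contDiffOn_of_hasFDerivAt_flip Metric.isOpen_ball
      (hf.contDiffOn_frameConnection.mono hsub') hc)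
  · simp only [hc0]
    exact h.eq_frame₀ hK hf hWU hxW hs₀
  · exact h.hasFDerivAt_of_frame hK hf hWU (hsub' hx) (hc x hx)

/-- A solution of the differential system which vanishes at `x₀` vanishes near `x₀`. -/
theorem FiniteTypeSystem.solution_unique (h : FiniteTypeSystem U M₁ M₀ pr sh π sh' r) {x₀ : X}
    (hx₀ : x₀ ∈ U) {V : Set X} (hV : IsOpen V) (hxV : x₀ ∈ V) {ξ : X → E₁}
    (h0 : pr (ξ x₀) = 0)
    (hξ : ∀ x ∈ V, M₁ x (ξ x) = 0 ∧ HasFDerivAt (fun y => pr (ξ y)) (sh.flip (ξ x)) x) :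
    ∀ᶠ x in 𝓝 x₀, pr (ξ x) = 0 := by
  obtain ⟨l, W, ι, hxW, hWU, hf⟩ := h.exists_frame hx₀
  have hK := h.finrank₀ x₀ hx₀
  obtain ⟨ρ, hρ, C, hC, hsub, hflat⟩ := exists_flatOnBall (hf.isOpen.inter hV) ⟨hxW, hxV⟩
    ((hf.contDiffOn_frameConnection (sh := sh)).mono Set.inter_subset_left)
    (fun x hx v w k => h.frameConnection_flat hK hf hWU hx.1 v w k)
  set ρ' := min ρ (1 / (2 * C)) with hρ'
  have hρ'0 : 0 < ρ' := by positivity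
  have hCr : C * ρ' ≤ 1 / 2 := by
    calc C * ρ' ≤ C * (1 / (2 * C)) := by gcongr; exact min_le_right _ _
      _ = 1 / 2 := by field_simp
  have hsub' : Metric.ball x₀ ρ' ⊆ W ∩ V :=
    (Metric.ball_subset_ball (min_le_left _ _)).trans hsub
  -- The frame recovers `ξ` from `l (pr ξ)`, so the latter is a parallel section and uniqueness for
  -- it is uniqueness for `ξ`.
  have hfr : ∀ x ∈ Metric.ball x₀ ρ', ι x (l (pr (ξ x))) = ξ x := fun x hx =>
    h.eq_frame₁ hK hf hWU (hsub' hx).1 (hξ x (hsub' hx).2).1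
  have hz := (hflat.mono (min_le_left _ _)).solution_unique hCr (c := fun x => l (pr (ξ x)))
    (by simp [h0]) (fun x hx => by
      refine (l.hasFDerivAt.comp x (hξ x (hsub' hx).2).2).congr_fderiv ?_
      ext1 v
      simp [hfr x hx])
  filter_upwards [Metric.ball_mem_nhds x₀ hρ'0] with x hx
  rw [← hfr x hx, hz x hx]
  simp

end FiniteType

/-! ### Injectivity of the symbol -/

section Symbol

open MvPolynomial

variable {n : ℕ}

/-- The linear form `∑ wᵢ Xᵢ`. -/
noncomputable def linForm {R : Type*} [CommSemiring R] (w : Fin n → R) : MvPolynomial (Fin n) R :=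
  ∑ i, C (w i) * X i

lemma isHomogeneous_linForm {R : Type*} [CommSemiring R] (w : Fin n → R) :
    (linForm w).IsHomogeneous 1 :=
  IsHomogeneous.sum _ _ _ fun i _ => isHomogeneous_C_mul_X (w i) i

lemma map_linForm {R S : Type*} [CommSemiring R] [CommSemiring S] (f : R →+* S) (w : Fin n → R) :
    map f (linForm w) = linForm fun i => f (w i) := by
  simp [linForm]

/-- The linear functional on polynomials with prescribed values on monomials. -/
noncomputable def monomialFunctional {R : Type*} [CommRing R] (y : (Fin n →₀ ℕ) → R) :
    MvPolynomial (Fin n) R →ₗ[R] R :=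
  (basisMonomials (Fin n) R).constr R y

lemma monomialFunctional_monomial {R : Type*} [CommRing R] (y : (Fin n →₀ ℕ) → R)
    (α : Fin n →₀ ℕ) (c : R) : monomialFunctional y (monomial α c) = c * y α := by
  have h1 : monomial α c = c • basisMonomials (Fin n) R α := by
    rw [coe_basisMonomials, smul_monomial, smul_eq_mul, mul_one]
  rw [h1, map_smul, monomialFunctional, Module.Basis.constr_basis, smul_eq_mul]

lemma monomialFunctional_apply {R : Type*} [CommRing R] (y : (Fin n →₀ ℕ) → R)
    (f : MvPolynomial (Fin n) R) :
    monomialFunctional y f = ∑ α ∈ f.support, coeff α f * y α := by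
  conv_lhs => rw [f.as_sum]
  rw [map_sum]
  exact Finset.sum_congr rfl fun α _ => monomialFunctional_monomial y α _

/-- The hypothesis says that the functional kills `X^β · ℓ_w` for each monomial of degree `m`;
linearity does the rest. -/
lemma monomialFunctional_mul_linForm {R : Type*} [CommRing R] {y : (Fin n →₀ ℕ) → R} {w : Fin n → R}
    {m : ℕ} (h : ∀ β : Fin n →₀ ℕ, β.degree = m → ∑ i, y (β + Finsupp.single i 1) * w i = 0)
    {f : MvPolynomial (Fin n) R} (hf : f.IsHomogeneous m) :
    monomialFunctional y (f * linForm w) = 0 := by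
  conv_lhs => rw [f.as_sum]
  rw [Finset.sum_mul, map_sum]
  refine Finset.sum_eq_zero fun β hβ => ?_
  have hd : β.degree = m := by
    have := hf (mem_support_iff.1 hβ)
    rw [Finsupp.degree_eq_weight_one (R := ℕ)]
    exact this
  rw [linForm, Finset.mul_sum, map_sum]
  have : ∀ i, monomial β (coeff β f) * (C (w i) * X i)
      = monomial (β + Finsupp.single i 1) (coeff β f * w i) := by
    intro i
    rw [C_mul_X_eq_monomial, monomial_mul]
  simp only [this, monomialFunctional_monomial]
  calc ∑ i, coeff β f * w i * y (β + Finsupp.single i 1)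
      = coeff β f * ∑ i, y (β + Finsupp.single i 1) * w i := by
        rw [Finset.mul_sum]
        exact Finset.sum_congr rfl fun i _ => by ring
    _ = 0 := by rw [h β hd, mul_zero]

/-- If a functional annihilates the multiples of `ℓ_a + s ℓ_w`, then it satisfies
`s ^ (m + 1) L(ℓ_w ^ (m + 1)) = (-1) ^ (m + 1) L(ℓ_a ^ (m + 1))`. -/
lemma monomialFunctional_pow {R : Type*} [CommRing R] {y : (Fin n →₀ ℕ) → R} {a w : Fin n → R}
    {s : R} {m : ℕ}
    (h : ∀ β : Fin n →₀ ℕ, β.degree = m → ∑ i, y (β + Finsupp.single i 1) * (a i + s * w i) = 0) :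
    s ^ (m + 1) * monomialFunctional y (linForm w ^ (m + 1))
      = (-1) ^ (m + 1) * monomialFunctional y (linForm a ^ (m + 1)) := by
  -- With `b = s ℓ_w` and `c = -ℓ_a`, the difference `b - c` is the annihilated form. It divides `b
  -- ^ (m + 1) - c ^ (m + 1)`, with a cofactor homogeneous of degree `m`.
  have e : (C s * linForm w) - (C (-1) * linForm a) = linForm fun i => a i + s * w i := by
    simp only [linForm, Finset.mul_sum, ← Finset.sum_sub_distrib]
    refine Finset.sum_congr rfl fun i _ => ?_
    simp only [C_add, C_mul, C_neg, C_1]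
    ring
  have hom : ∀ (c : R) (v : Fin n → R), (C c * linForm v).IsHomogeneous 1 := fun c v => by
    simpa using (isHomogeneous_C (Fin n) c).mul (isHomogeneous_linForm v)
  have hq : (∑ i ∈ Finset.range (m + 1), (C s * linForm w) ^ i
      * (C (-1) * linForm a) ^ (m + 1 - 1 - i)).IsHomogeneous m := by
    refine IsHomogeneous.sum _ _ _ fun i hi => ?_
    have := ((hom s w).pow i).mul ((hom (-1) a).pow (m + 1 - 1 - i))
    have hm : 1 * i + 1 * (m + 1 - 1 - i) = m := by
      have := Finset.mem_range.1 hi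
      omega
    rwa [hm] at this
  have h1 := monomialFunctional_mul_linForm h hq
  rw [← e, geom_sum₂_mul, map_sub, sub_eq_zero, mul_pow, mul_pow, ← C_pow, ← C_pow, C_mul', C_mul',
    map_smul, map_smul] at h1
  exact h1

lemma natDegree_monomialFunctional_le {d : ℕ} {y : (Fin n →₀ ℕ) → Polynomial ℝ}
    (hy : ∀ α, (y α).natDegree ≤ d) (f : MvPolynomial (Fin n) ℝ) :
    (monomialFunctional y (map Polynomial.C f)).natDegree ≤ d := by
  rw [monomialFunctional_apply]
  refine Polynomial.natDegree_sum_le_of_forall_le _ _ fun α _ => ?_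
  rw [coeff_map]
  exact (Polynomial.natDegree_C_mul_le _ _).trans (hy α)

lemma monomialFunctional_linForm_pow (y : (Fin n →₀ ℕ) → ℝ) (w : Fin n → ℝ) (m : ℕ) :
    monomialFunctional y (linForm w ^ m) = eval w (∑ k ∈ Finset.piAntidiag Finset.univ m,
      monomial (Finsupp.equivFunOnFinite.symm k)
        ((Nat.multinomial Finset.univ k : ℝ) * y (Finsupp.equivFunOnFinite.symm k))) := by
  rw [linForm, Finset.sum_pow_eq_sum_piAntidiag, map_sum, map_sum]
  refine Finset.sum_congr rfl fun k _ => ?_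
  have e : (Nat.multinomial Finset.univ k : MvPolynomial (Fin n) ℝ) * ∏ i, (C (w i) * X i) ^ k i
      = monomial (Finsupp.equivFunOnFinite.symm k)
        ((Nat.multinomial Finset.univ k : ℝ) * ∏ i, w i ^ k i) := by
    rw [monomial_eq, C_mul, map_prod, Finsupp.prod_fintype _ _ (by simp)]
    simp only [mul_pow, Finset.prod_mul_distrib, C_pow, Finsupp.equivFunOnFinite_symm_apply_apply]
    simp [mul_assoc]
  rw [e, monomialFunctional_monomial, eval_monomial, Finsupp.prod_fintype _ _ (by simp)]
  simp only [Finsupp.equivFunOnFinite_symm_apply_apply]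
  ring

/-- By the multinomial theorem the values at `ℓ_w ^ m` form a polynomial in `w` whose coefficients
are the `y α` times positive multinomial coefficients. -/
lemma eq_zero_of_monomialFunctional_linForm_pow {y : (Fin n →₀ ℕ) → ℝ} {m : ℕ}
    (h : ∀ w : Fin n → ℝ, monomialFunctional y (linForm w ^ m) = 0) {α : Fin n →₀ ℕ}
    (hα : α.degree = m) : y α = 0 := by
  have h0 : (∑ k ∈ Finset.piAntidiag Finset.univ m,
      monomial (Finsupp.equivFunOnFinite.symm k)
        ((Nat.multinomial Finset.univ k : ℝ) * y (Finsupp.equivFunOnFinite.symm k)) :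
          MvPolynomial (Fin n) ℝ) = 0 :=
    MvPolynomial.funext fun w => by rw [← monomialFunctional_linForm_pow, h w, map_zero]
  have h1 := congrArg (coeff α) h0
  rw [coeff_sum, Finset.sum_eq_single (α : Fin n → ℕ)] at h1
  · have e : Finsupp.equivFunOnFinite.symm (α : Fin n → ℕ) = α := by ext; simp
    rw [e, coeff_monomial, if_pos rfl, coeff_zero] at h1
    refine (mul_eq_zero.1 h1).resolve_left ?_
    exact_mod_cast (Nat.multinomial_pos _ _).ne'
  · intro k _ hk
    rw [coeff_monomial, if_neg]
    rintro rfl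
    exact hk (by ext; simp)
  · intro hn
    refine absurd ?_ hn
    rw [Finset.mem_piAntidiag]
    exact ⟨by rw [← hα, Finsupp.degree_eq_sum], by simp⟩

/-- A family of polynomials `P_α` of degree at most `d < m + 1` with
`∑ i, P_{β + 1_i}(p) (A p)_i = 0` for `|β| = m` vanishes for `|α| = m + 1`. -/
theorem symbol_injective {d m : ℕ} (hdm : d < m + 1) {A : Matrix (Fin n) (Fin n) ℝ}
    (hA : IsUnit A) {P : (Fin n →₀ ℕ) → MvPolynomial (Fin n) ℝ} (hP : ∀ α, (P α).totalDegree ≤ d)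
    (h : ∀ β : Fin n →₀ ℕ, β.degree = m →
      ∑ i, P (β + Finsupp.single i 1) * linForm (A i) = 0)
    {α : Fin n →₀ ℕ} (hα : α.degree = m + 1) : P α = 0 := by
  refine MvPolynomial.funext fun p => ?_
  rw [map_zero]
  refine eq_zero_of_monomialFunctional_linForm_pow (y := fun α => eval p (P α)) (fun w => ?_) hα
  obtain ⟨u, rfl⟩ := (Matrix.mulVec_surjective_iff_isUnit.2 hA) w
  -- Restriction to the line `p + s u`, where `A u` is the vector at which the functional is tested.
  -- The relations become annihilation of the multiples of `ℓ_{Ap} + s ℓ_{Au}`.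
  set φ : MvPolynomial (Fin n) ℝ →ₐ[ℝ] Polynomial ℝ :=
    aeval fun i => Polynomial.C (p i) + Polynomial.X * Polynomial.C (u i) with hφ
  have hdeg : ∀ α, (φ (P α)).natDegree ≤ d := fun α => by
    refine (aeval_natDegree_le (m := d) (n := 1) (P α) (hP α) _ fun i => ?_).trans (by simp)
    refine (Polynomial.natDegree_add_le _ _).trans ?_
    simpa using Polynomial.natDegree_mul_C_le (Polynomial.X : Polynomial ℝ) (u i)
  have hlin : ∀ i, φ (linForm (A i)) = Polynomial.C (A.mulVec p i)
      + Polynomial.X * Polynomial.C (A.mulVec u i) := by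
    intro i
    simp only [hφ, linForm, map_sum, map_mul, aeval_X, aeval_C, Matrix.mulVec, dotProduct,
      Finset.mul_sum, Polynomial.algebraMap_eq, ← Finset.sum_add_distrib]
    exact Finset.sum_congr rfl fun k _ => by ring
  have hpow := monomialFunctional_pow (y := fun α => φ (P α))
    (a := fun i => Polynomial.C (A.mulVec p i)) (w := fun i => Polynomial.C (A.mulVec u i))
    (s := Polynomial.X) (m := m) fun β hβ => by
      have := congrArg φ (h β hβ)
      simpa only [map_sum, map_mul, hlin, map_zero] using this
  rw [← map_linForm, ← map_linForm, ← map_pow, ← map_pow] at hpow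
  have hzero : monomialFunctional (fun α => φ (P α))
      (map Polynomial.C (linForm (A.mulVec u) ^ (m + 1))) = 0 := by
    -- A nonzero left side of `hpow` has degree at least `m + 1` in `s`, whereas the right side has
    -- degree at most `d`.
    by_contra hne
    have h1 := congrArg Polynomial.natDegree hpow
    rw [Polynomial.natDegree_X_pow_mul _ hne] at h1
    have h2 : ((-1 : Polynomial ℝ) ^ (m + 1) * monomialFunctional (fun α => φ (P α))
        (map Polynomial.C (linForm (A.mulVec p) ^ (m + 1)))).natDegree ≤ d := by
      have e : (-1 : Polynomial ℝ) ^ (m + 1) = Polynomial.C ((-1) ^ (m + 1)) := by simp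
      rw [e]
      exact (Polynomial.natDegree_C_mul_le _ _).trans (natDegree_monomialFunctional_le hdeg _)
    omega
  -- At `s = 0` the line is at `p`, which turns `φ (P α)` back into the value `P α (p)`.
  have h0 := congrArg (Polynomial.eval 0) hzero
  rw [monomialFunctional_apply, Polynomial.eval_finsetSum, Polynomial.eval_zero,
    support_map_of_injective _ Polynomial.C_injective] at h0
  rw [monomialFunctional_apply, ← h0]
  refine Finset.sum_congr rfl fun α _ => ?_
  have he : Polynomial.eval 0 (φ (P α)) = eval p (P α) := by
    have : (Polynomial.aeval (0 : ℝ)).comp φ = aeval p := by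
      ext i
      simp [hφ]
    have h2 := DFunLike.congr_fun this (P α)
    rw [AlgHom.comp_apply, Polynomial.coe_aeval_eq_eval] at h2
    rw [h2, ← coe_aeval_eq_eval]
    rfl
  rw [coeff_map, Polynomial.eval_mul, Polynomial.eval_C, he]

end Symbol

/-! ### Iterated operators -/

section IterOp

variable {n : ℕ} {A : Type*}

/-- Operators `D_q` which preserve a class `S` of objects, respect a transitive relation `R` on it
and commute up to `R`. -/
structure CommuteUpTo (D : Fin n → A → A) (S : A → Prop) (R : A → A → Prop) : Prop where
  mem : ∀ q F, S F → S (D q F)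
  refl : ∀ F, R F F
  trans : ∀ F G H, R F G → R G H → R F H
  congr : ∀ q F G, S F → S G → R F G → R (D q F) (D q G)
  comm : ∀ q r F, S F → R (D q (D r F)) (D r (D q F))

variable {D : Fin n → A → A} {S : A → Prop} {R : A → A → Prop}

lemma CommuteUpTo.mem_iterate (h : CommuteUpTo D S R) (q : Fin n) (k : ℕ) {F : A} (hF : S F) :
    S ((D q)^[k] F) := by
  induction k with
  | zero => exact hF
  | succ k ih =>
    rw [Function.iterate_succ_apply']
    exact h.mem q _ ih

lemma CommuteUpTo.iterate_congr (h : CommuteUpTo D S R) (q : Fin n) (k : ℕ) {F G : A} (hF : S F)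
    (hG : S G) (hFG : R F G) : R ((D q)^[k] F) ((D q)^[k] G) := by
  induction k with
  | zero => exact hFG
  | succ k ih =>
    rw [Function.iterate_succ_apply', Function.iterate_succ_apply']
    exact h.congr q _ _ (h.mem_iterate q k hF) (h.mem_iterate q k hG) ih

lemma CommuteUpTo.iterate_comm (h : CommuteUpTo D S R) (q r : Fin n) (k : ℕ) {F : A} (hF : S F) :
    R ((D r)^[k] (D q F)) (D q ((D r)^[k] F)) := by
  induction k with
  | zero => exact h.refl _
  | succ k ih =>
    rw [Function.iterate_succ_apply', Function.iterate_succ_apply']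
    exact h.trans _ _ _ (h.congr r _ _ (h.mem_iterate r k (h.mem q F hF))
      (h.mem q _ (h.mem_iterate r k hF)) ih) (h.comm r q _ (h.mem_iterate r k hF))

lemma CommuteUpTo.mem_foldr (h : CommuteUpTo D S R) (β : Fin n →₀ ℕ) (l : List (Fin n)) {F : A}
    (hF : S F) : S (l.foldr (fun q G => (D q)^[β q] G) F) := by
  induction l with
  | nil => exact hF
  | cons r l ih => exact h.mem_iterate r _ ih

lemma CommuteUpTo.mem_iterOp (h : CommuteUpTo D S R) (β : Fin n →₀ ℕ) {F : A} (hF : S F) :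
    S (iterOp D β F) := h.mem_foldr β _ hF

lemma foldr_add_single_of_notMem (D : Fin n → A → A) (β : Fin n →₀ ℕ) {q : Fin n}
    {l : List (Fin n)} (hq : q ∉ l) (F : A) :
    l.foldr (fun r G => (D r)^[(β + Finsupp.single q 1 : Fin n →₀ ℕ) r] G) F
      = l.foldr (fun r G => (D r)^[β r] G) F := by
  induction l with
  | nil => rfl
  | cons r l ih =>
    rw [List.mem_cons, not_or] at hq
    rw [List.foldr_cons, List.foldr_cons, ih hq.2, Finsupp.add_apply,
      Finsupp.single_eq_of_ne' hq.1, add_zero]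

/-- If `q` heads the list, the extra operator is already outermost; otherwise it is moved out
through the iterates of the head. Since there are no repetitions, it enters only once. -/
lemma CommuteUpTo.foldr_add_single (h : CommuteUpTo D S R) (β : Fin n →₀ ℕ) (q : Fin n)
    {l : List (Fin n)} (hl : l.Nodup) (hq : q ∈ l) {F : A} (hF : S F) :
    R (l.foldr (fun r G => (D r)^[(β + Finsupp.single q 1 : Fin n →₀ ℕ) r] G) F)
      (D q (l.foldr (fun r G => (D r)^[β r] G) F)) := by
  induction l with
  | nil => simp at hq
  | cons r l ih =>
    rw [List.nodup_cons] at hl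
    by_cases hqr : q = r
    · subst hqr
      rw [List.foldr_cons, List.foldr_cons, foldr_add_single_of_notMem D β hl.1, Finsupp.add_apply,
        Finsupp.single_eq_same, Function.iterate_succ_apply']
      exact h.refl _
    · have hql : q ∈ l := (List.mem_cons.1 hq).resolve_left hqr
      rw [List.foldr_cons, List.foldr_cons]
      have hβr : (β + Finsupp.single q 1 : Fin n →₀ ℕ) r = β r := by
        rw [Finsupp.add_apply, Finsupp.single_eq_of_ne' hqr, add_zero]
      rw [hβr]
      refine h.trans _ _ _ (h.iterate_congr r _ (h.mem_foldr _ l hF)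
        (h.mem q _ (h.mem_foldr β l hF)) ?_) (h.iterate_comm q r _ (h.mem_foldr β l hF))
      exact ih hl.2 hql

/-- The recursion behind the inductions on `|β|`: one derivative can be split off as the last one
applied, although `iterOp` fixes an order. -/
lemma CommuteUpTo.iterOp_add_single (h : CommuteUpTo D S R) (β : Fin n →₀ ℕ) (q : Fin n) {F : A}
    (hF : S F) : R (iterOp D (β + Finsupp.single q 1) F) (D q (iterOp D β F)) :=
  h.foldr_add_single β q (List.nodup_finRange n) (List.mem_finRange q) hF

@[simp]
lemma iterOp_zero (D : Fin n → A → A) (F : A) : iterOp D 0 F = F := by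
  simp [iterOp]

lemma exists_eq_add_single {β : Fin n →₀ ℕ} {k : ℕ} (hβ : β.degree = k + 1) :
    ∃ (β' : Fin n →₀ ℕ) (q : Fin n), β = β' + Finsupp.single q 1 ∧ β'.degree = k := by
  have hne : β ≠ 0 := by
    rintro rfl
    simp at hβ
  obtain ⟨q, hq⟩ := Finsupp.ne_iff.1 hne
  have hle : Finsupp.single q 1 ≤ β := by
    rw [Finsupp.single_le_iff]
    exact Nat.one_le_iff_ne_zero.2 hq
  refine ⟨β - Finsupp.single q 1, q, (tsub_add_cancel_of_le hle).symm, ?_⟩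
  have := congrArg Finsupp.degree (tsub_add_cancel_of_le hle)
  rw [map_add, Finsupp.degree_single] at this
  omega

end IterOp

/-! ### Partial and total derivatives of smooth objects -/

section Smooth

variable {n d : ℕ} {U : Set (Coord n)}

lemma contDiffOn_pd (hU : IsOpen U) {f : Coord n → ℝ} (hf : ContDiffOn ℝ ∞ f U) (i : Fin n) :
    ContDiffOn ℝ ∞ (pd i f) U :=
  (hf.fderiv_of_isOpen hU (m := ∞) (by simp)).clm_apply contDiffOn_const

lemma eqOn_pd (hU : IsOpen U) {f g : Coord n → ℝ} (h : Set.EqOn f g U) (i : Fin n) :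
    Set.EqOn (pd i f) (pd i g) U := fun x hx => by
  have : f =ᶠ[𝓝 x] g := h.eventuallyEq_of_mem (hU.mem_nhds hx)
  simp only [pd, this.fderiv_eq]

lemma pd_comm (hU : IsOpen U) {f : Coord n → ℝ} (hf : ContDiffOn ℝ ∞ f U) (q r : Fin n) :
    Set.EqOn (pd q (pd r f)) (pd r (pd q f)) U := by
  intro x hx
  have hfx := hf.contDiffAt (hU.mem_nhds hx)
  have hd : DifferentiableAt ℝ (fderiv ℝ f) x :=
    (hfx.fderiv_right (m := 1) (by norm_cast)).differentiableAt (by simp)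
  have hs : IsSymmSndFDerivAt ℝ f x := hfx.isSymmSndFDerivAt (by
    rw [minSmoothness_of_isRCLikeNormedField]
    exact WithTop.coe_le_coe.2 le_top)
  have key : ∀ q r, pd q (pd r f) x = fderiv ℝ (fderiv ℝ f) x (EuclideanSpace.single q 1)
      (EuclideanSpace.single r 1) := by
    intro q r
    have := hd.hasFDerivAt.clm_apply (hasFDerivAt_const (EuclideanSpace.single r (1 : ℝ)) x)
    unfold pd
    rw [this.fderiv]
    simp
  rw [key, key, hs.eq]

lemma pd_add {f g : Coord n → ℝ} {x : Coord n} (hf : DifferentiableAt ℝ f x)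
    (hg : DifferentiableAt ℝ g x) (i : Fin n) :
    pd i (fun y => f y + g y) x = pd i f x + pd i g x := by
  simpa using pd_lin i 1 hf hg

lemma differentiableAt_of_smoothOn {f : Coord n → ℝ} (hf : ContDiffOn ℝ ∞ f U) (hU : IsOpen U)
    {x : Coord n} (hx : x ∈ U) : DifferentiableAt ℝ f x :=
  (hf.contDiffAt (hU.mem_nhds hx)).differentiableAt (by simp)

lemma commuteUpTo_pd (hU : IsOpen U) :
    CommuteUpTo pd (fun f : Coord n → ℝ => ContDiffOn ℝ ∞ f U) (fun f g => Set.EqOn f g U) where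
  mem q _ hf := contDiffOn_pd hU hf q
  refl f := Set.eqOn_refl f U
  trans _ _ _ h₁ h₂ := h₁.trans h₂
  congr q _ _ _ _ h := eqOn_pd hU h q
  comm q r _ hf := pd_comm hU hf q r

/-- The coefficients of a linear differential expression are smooth on `U`. -/
def SmoothJet (U : Set (Coord n)) (F : LinJet n d) : Prop := ∀ I α, ContDiffOn ℝ ∞ (F I α) U

/-- Two linear differential expressions agree over `U`. -/
def EqJet (U : Set (Coord n)) (F G : LinJet n d) : Prop := ∀ I α, Set.EqOn (F I α) (G I α) U

lemma SmoothJet.totalDeriv (hU : IsOpen U) {F : LinJet n d} (hF : SmoothJet U F) (q : Fin n) :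
    SmoothJet U (totalDeriv q F) := by
  intro I α
  unfold KillingProlongation.totalDeriv
  refine (contDiffOn_pd hU (hF I α) q).add ?_
  by_cases h : 1 ≤ α q
  · simpa only [h, if_true] using hF I _
  · simpa only [h, if_false] using contDiffOn_const

/-- Written out in a form whose symmetry in `q` and `r` is visible. The single condition `1_q + 1_r
≤ α` in the last term covers the case `q = r` as well. -/
lemma totalDeriv_totalDeriv (hU : IsOpen U) {F : LinJet n d} (hF : SmoothJet U F) (q r : Fin n)
    (I : MultiEq n d) (α : Fin n →₀ ℕ) {x : Coord n} (hx : x ∈ U) :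
    totalDeriv q (totalDeriv r F) I α x = pd q (pd r (F I α)) x
      + (if 1 ≤ α r then pd q (F I (α - Finsupp.single r 1)) x else 0)
      + (if 1 ≤ α q then pd r (F I (α - Finsupp.single q 1)) x else 0)
      + (if Finsupp.single q 1 + Finsupp.single r 1 ≤ α then
          F I (α - Finsupp.single q 1 - Finsupp.single r 1) x else 0) := by
  have hc : (1 ≤ α q ∧ 1 ≤ (α - Finsupp.single q 1 : Fin n →₀ ℕ) r)
      ↔ Finsupp.single q 1 + Finsupp.single r 1 ≤ α := by
    rw [← Finsupp.single_le_iff, ← Finsupp.single_le_iff]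
    constructor
    · rintro ⟨h1, h2⟩
      exact (add_le_add_right h2 _).trans_eq (add_tsub_cancel_of_le h1)
    · intro h
      exact ⟨le_self_add.trans h, le_tsub_of_add_le_left h⟩
  have e1 : pd q (totalDeriv r F I α) x = pd q (pd r (F I α)) x
      + if 1 ≤ α r then pd q (F I (α - Finsupp.single r 1)) x else 0 := by
    unfold totalDeriv
    by_cases h : 1 ≤ α r
    · simp only [h, if_true]
      exact pd_add (differentiableAt_of_smoothOn (contDiffOn_pd hU (hF I α) r) hU hx)
        (differentiableAt_of_smoothOn (hF I _) hU hx) q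
    · simp only [h, if_false, add_zero]
  have e2 : totalDeriv q (totalDeriv r F) I α x = pd q (totalDeriv r F I α) x
      + if 1 ≤ α q then totalDeriv r F I (α - Finsupp.single q 1) x else 0 := rfl
  have e3 : totalDeriv r F I (α - Finsupp.single q 1) x = pd r (F I (α - Finsupp.single q 1)) x
      + if 1 ≤ (α - Finsupp.single q 1 : Fin n →₀ ℕ) r then
        F I (α - Finsupp.single q 1 - Finsupp.single r 1) x else 0 := rfl
  rw [e2, e1, e3, ← if_congr hc rfl rfl]
  by_cases h1 : 1 ≤ α q <;> by_cases h2 : 1 ≤ (α - Finsupp.single q 1 : Fin n →₀ ℕ) r <;>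
    simp only [h1, h2, and_true, and_false, if_true, if_false, add_zero, add_assoc]

lemma commuteUpTo_totalDeriv (hU : IsOpen U) :
    CommuteUpTo (totalDeriv (d := d)) (SmoothJet U) (EqJet U) where
  mem q F hF := hF.totalDeriv hU q
  refl F I α := Set.eqOn_refl _ U
  trans F G H h₁ h₂ I α := (h₁ I α).trans (h₂ I α)
  congr q F G _ _ h I α x hx := by
    simp only [totalDeriv, eqOn_pd hU (h I α) q hx, h I _ hx]
  comm q r F hF I α x hx := by
    rw [totalDeriv_totalDeriv hU hF q r I α hx, totalDeriv_totalDeriv hU hF r q I α hx,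
      pd_comm hU (hF I α) q r hx, add_comm (Finsupp.single q 1), tsub_right_comm]
    ring

/-- Over `U`, the expression `F` involves only the variables `a^I_α` with `|α| ≤ m`. -/
def OrderLE (U : Set (Coord n)) (m : ℕ) (F : LinJet n d) : Prop :=
  ∀ I α, m < α.degree → Set.EqOn (F I α) 0 U

lemma OrderLE.mono {F : LinJet n d} {m m' : ℕ} (h : OrderLE U m F) (hm : m ≤ m') :
    OrderLE U m' F := fun I α hα => h I α (hm.trans_lt hα)

lemma OrderLE.congr {F G : LinJet n d} {m : ℕ} (h : OrderLE U m F) (hFG : EqJet U G F) :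
    OrderLE U m G := fun I α hα => (hFG I α).trans (h I α hα)

lemma pd_zero (i : Fin n) : pd i (0 : Coord n → ℝ) = 0 := by
  ext x
  simp [pd]

lemma OrderLE.pd (hU : IsOpen U) {F : LinJet n d} {m : ℕ} (h : OrderLE U m F) (q : Fin n) :
    OrderLE U m (fun I α => KillingProlongation.pd q (F I α)) := fun I α hα => by
  have := eqOn_pd hU (h I α hα) q
  rwa [pd_zero] at this

lemma degree_sub_single {α : Fin n →₀ ℕ} {q : Fin n} (h : 1 ≤ α q) :
    (α - Finsupp.single q 1).degree + 1 = α.degree := by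
  have hle : Finsupp.single q 1 ≤ α := Finsupp.single_le_iff.2 h
  have := congrArg Finsupp.degree (tsub_add_cancel_of_le hle)
  rwa [map_add, Finsupp.degree_single] at this

lemma OrderLE.totalDeriv (hU : IsOpen U) {F : LinJet n d} {m : ℕ} (h : OrderLE U m F) (q : Fin n) :
    OrderLE U (m + 1) (totalDeriv q F) := fun I α hα x hx => by
  unfold KillingProlongation.totalDeriv
  have h0 : KillingProlongation.pd q (F I α) x = 0 := h.pd hU q I α (by omega) hx
  rw [h0]
  by_cases h1 : 1 ≤ α q
  · have := degree_sub_single h1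
    rw [if_pos h1, h I _ (by omega) hx]
    simp
  · simp [h1]

lemma OrderLE.iterOp (hU : IsOpen U) {F : LinJet n d} {m : ℕ} (h : OrderLE U m F)
    (hF : SmoothJet U F) {k : ℕ} {β : Fin n →₀ ℕ} (hβ : β.degree = k) :
    OrderLE U (m + k) (iterOp KillingProlongation.totalDeriv β F) := by
  induction k generalizing β with
  | zero =>
    rw [Finsupp.degree_eq_zero_iff] at hβ
    subst hβ
    simpa using h
  | succ k ih =>
    obtain ⟨β', q, rfl, hβ'⟩ := exists_eq_add_single hβ
    exact ((ih hβ').totalDeriv hU q).congr ((commuteUpTo_totalDeriv hU).iterOp_add_single β' q hF)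

end Smooth

/-! ### Jets -/

section Jets

variable {n d : ℕ}

/-- The index type of the jets of order at most `m`. -/
abbrev JetIdx (n d m : ℕ) : Type := MultiEq n d × MultiLE n m

/-- The inclusion of the variables of order at most `m` into those of order at most `m + 1`. -/
def inclIdx {m : ℕ} (v : JetIdx n d m) : JetIdx n d (m + 1) :=
  (v.1, ⟨v.2.1, v.2.2.trans (Nat.le_succ _)⟩)

/-- The variable `a^I_{α + 1_q}`. -/
noncomputable def shiftIdx {m : ℕ} (q : Fin n) (v : JetIdx n d m) : JetIdx n d (m + 1) :=
  (v.1, ⟨v.2.1 + Finsupp.single q 1, by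
    rw [map_add, Finsupp.degree_single]; exact Nat.succ_le_succ v.2.2⟩)

lemma inclIdx_injective {m : ℕ} : Function.Injective (inclIdx (n := n) (d := d) (m := m)) := by
  rintro ⟨I, α, hα⟩ ⟨J, β, hβ⟩ h
  simpa [inclIdx] using h

lemma shiftIdx_injective {m : ℕ} (q : Fin n) :
    Function.Injective (shiftIdx (d := d) (m := m) q) := by
  rintro ⟨I, α, hα⟩ ⟨J, β, hβ⟩ h
  simpa [shiftIdx] using h

lemma shiftIdx_inclIdx {m : ℕ} (q : Fin n) (v : JetIdx n d m) :
    shiftIdx q (inclIdx v) = inclIdx (shiftIdx q v) := rfl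

lemma shiftIdx_comm {m : ℕ} (q r : Fin n) (v : JetIdx n d m) :
    shiftIdx q (shiftIdx r v) = shiftIdx r (shiftIdx q v) := by
  simp only [shiftIdx, add_right_comm]

/-- The value of the linear expression `F` on a jet of order `m` at `x`. -/
noncomputable def evalJet (F : LinJet n d) {m : ℕ} (ξ : JetIdx n d m → ℝ) (x : Coord n) : ℝ :=
  ∑ v : JetIdx n d m, F v.1 v.2.1 x * ξ v

variable {U : Set (Coord n)}

lemma evalJet_incl {F : LinJet n d} {m : ℕ} (hF : OrderLE U m F) {x : Coord n} (hx : x ∈ U)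
    (ξ : JetIdx n d (m + 1) → ℝ) : evalJet F ξ x = evalJet F (fun v => ξ (inclIdx v)) x := by
  symm
  refine Fintype.sum_of_injective inclIdx inclIdx_injective _ _ (fun v hv => ?_) (fun v => rfl)
  rw [hF v.1 v.2.1 ?_ hx, Pi.zero_apply, zero_mul]
  by_contra hlt
  exact hv ⟨(v.1, ⟨v.2.1, not_lt.1 hlt⟩), rfl⟩

/-- The two terms of the product rule: either the coefficients are differentiated, or the jet is
shifted. The second is the reindexing `α ↦ α + 1_q`. -/
lemma evalJet_totalDeriv (hU : IsOpen U) {F : LinJet n d} {m : ℕ} (hF : OrderLE U m F)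
    {x : Coord n} (hx : x ∈ U) (q : Fin n) (ξ : JetIdx n d (m + 1) → ℝ) :
    evalJet (totalDeriv q F) ξ x = evalJet (fun I α => pd q (F I α)) (fun v => ξ (inclIdx v)) x
      + evalJet F (fun v => ξ (shiftIdx q v)) x := by
  rw [← evalJet_incl (hF.pd hU q) hx]
  have h2 : evalJet F (fun v => ξ (shiftIdx q v)) x = ∑ v : JetIdx n d (m + 1),
      (if 1 ≤ v.2.1 q then F v.1 (v.2.1 - Finsupp.single q 1) x else 0) * ξ v := by
    refine Fintype.sum_of_injective (shiftIdx q) (shiftIdx_injective q) _ _ (fun v hv => ?_)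
      (fun v => ?_)
    · rw [if_neg, zero_mul]
      intro h1
      refine hv ⟨(v.1, ⟨v.2.1 - Finsupp.single q 1, ?_⟩), ?_⟩
      · have := degree_sub_single h1
        have := v.2.2
        omega
      · have hle : Finsupp.single q 1 ≤ v.2.1 := Finsupp.single_le_iff.2 h1
        simp only [shiftIdx, tsub_add_cancel_of_le hle]
    · simp [shiftIdx]
  rw [h2, evalJet, evalJet, ← Finset.sum_add_distrib]
  exact Finset.sum_congr rfl fun v _ => by rw [totalDeriv, add_mul]

/-- The truncation of jets as a continuous linear map. -/
noncomputable def truncL (n d m : ℕ) : (JetIdx n d (m + 1) → ℝ) →L[ℝ] (JetIdx n d m → ℝ) :=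
  ContinuousLinearMap.pi fun v => ContinuousLinearMap.proj (inclIdx v)

@[simp] lemma truncL_apply {m : ℕ} (ξ : JetIdx n d (m + 1) → ℝ) (v : JetIdx n d m) :
    truncL n d m ξ v = ξ (inclIdx v) := rfl

/-- The map sending the jet of `a` to the jet of `∂a/∂x^q`. -/
noncomputable def shiftL {m : ℕ} (q : Fin n) : (JetIdx n d (m + 1) → ℝ) →L[ℝ] (JetIdx n d m → ℝ) :=
  ContinuousLinearMap.pi fun v => ContinuousLinearMap.proj (shiftIdx q v)

@[simp] lemma shiftL_apply {m : ℕ} (q : Fin n) (ξ : JetIdx n d (m + 1) → ℝ) (v : JetIdx n d m) :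
    shiftL q ξ v = ξ (shiftIdx q v) := rfl

/-- The map sending a direction `w` and the jet of `a` to the jet of the derivative of `a` along
`w`. -/
noncomputable def dirShift (n d m : ℕ) : Coord n →L[ℝ] (JetIdx n d (m + 1) → ℝ) →L[ℝ] (JetIdx n d m → ℝ) :=
  ∑ q, (EuclideanSpace.proj q : Coord n →L[ℝ] ℝ).smulRight (shiftL q)

lemma dirShift_apply {m : ℕ} (w : Coord n) (ξ : JetIdx n d (m + 1) → ℝ) :
    dirShift n d m w ξ = ∑ q, w q • shiftL q ξ := by
  simp [dirShift]

lemma truncL_dirShift {m : ℕ} (w : Coord n) (ξ : JetIdx n d (m + 1 + 1) → ℝ) :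
    truncL n d m (dirShift n d (m + 1) w ξ) = dirShift n d m w (truncL n d (m + 1) ξ) := by
  ext v
  simp [dirShift_apply, shiftIdx_inclIdx]

lemma dirShift_comm {m : ℕ} (u w : Coord n) (ξ : JetIdx n d (m + 1 + 1) → ℝ) :
    dirShift n d m w (dirShift n d (m + 1) u ξ) = dirShift n d m u (dirShift n d (m + 1) w ξ) := by
  ext v
  simp only [dirShift_apply, Finset.sum_apply, Pi.smul_apply, shiftL_apply, smul_eq_mul,
    Finset.mul_sum]
  rw [Finset.sum_comm]
  refine Finset.sum_congr rfl fun q _ => Finset.sum_congr rfl fun r _ => ?_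
  rw [shiftIdx_comm]
  ring

lemma coord_eq_sum (w : Coord n) : w = ∑ q, w q • EuclideanSpace.single q (1 : ℝ) := by
  ext i
  simp [Finset.sum_apply, Pi.single_apply]

end Jets

/-! ### The Killing equation as a polynomial in the momenta -/

section KillingPoly

open MvPolynomial

variable {n d : ℕ}

/-- The matrix function `G` is a smooth pseudo-Riemannian metric on the open set `U`. -/
structure IsMetricOn (G : Coord n → Matrix (Fin n) (Fin n) ℝ) (U : Set (Coord n)) : Prop where
  isOpen : IsOpen U
  smooth : ∀ i j, ContDiffOn ℝ ∞ (fun x => G x i j) U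
  symm : ∀ x ∈ U, (G x).IsSymm
  isUnit : ∀ x ∈ U, IsUnit (G x)

lemma contDiffOn_det {U : Set (Coord n)} {M : Coord n → Matrix (Fin n) (Fin n) ℝ}
    (hM : ∀ i j, ContDiffOn ℝ ∞ (fun x => M x i j) U) : ContDiffOn ℝ ∞ (fun x => (M x).det) U := by
  simp only [Matrix.det_apply]
  exact ContDiffOn.sum fun σ _ => (contDiffOn_prod fun i _ => hM _ _).const_smul _

variable {G : Coord n → Matrix (Fin n) (Fin n) ℝ} {U : Set (Coord n)}

/-- Cramer's rule. -/
lemma IsMetricOn.contDiffOn_inv (hG : IsMetricOn G U) (i j : Fin n) :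
    ContDiffOn ℝ ∞ (fun x => (G x)⁻¹ i j) U := by
  have h1 : ContDiffOn ℝ ∞ (fun x => ((G x).det)⁻¹) U :=
    (contDiffOn_det hG.smooth).inv fun x hx => ((Matrix.isUnit_iff_isUnit_det _).1
      (hG.isUnit x hx)).ne_zero
  have h2 : ContDiffOn ℝ ∞ (fun x => (G x).adjugate i j) U := by
    simp only [Matrix.adjugate_apply]
    refine contDiffOn_det fun r c => ?_
    by_cases hr : r = j
    · subst hr
      simpa only [Matrix.updateRow_self] using contDiffOn_const
    · simpa only [Matrix.updateRow_ne hr] using hG.smooth r c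
  simp only [Matrix.inv_def, Ring.inverse_eq_inv', Matrix.smul_apply, smul_eq_mul]
  exact h1.mul h2

lemma IsMetricOn.symm_inv (hG : IsMetricOn G U) {x : Coord n} (hx : x ∈ U) (i j : Fin n) :
    (G x)⁻¹ i j = (G x)⁻¹ j i := (hG.symm x hx).inv.apply j i

lemma pderiv_hamiltonianPoly (G : Coord n → Matrix (Fin n) (Fin n) ℝ) (x : Coord n) (i : Fin n) :
    pderiv i (hamiltonianPoly G x)
      = ∑ j, ∑ k, C (1 / 2 * (G x)⁻¹ j k) * pderiv i (X j * X k) := by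
  simp only [hamiltonianPoly, map_sum, mul_assoc, pderiv_C_mul]

lemma IsMetricOn.pderiv_hamiltonianPoly (hG : IsMetricOn G U) {x : Coord n} (hx : x ∈ U)
    (i : Fin n) : pderiv i (hamiltonianPoly G x) = linForm ((G x)⁻¹ i) := by
  have e : ∀ j k, C (1 / 2 * (G x)⁻¹ j k) * pderiv i (X j * X k : MvPolynomial (Fin n) ℝ)
      = (if i = k then C (1 / 2 * (G x)⁻¹ j k) * X j else 0)
        + (if i = j then C (1 / 2 * (G x)⁻¹ j k) * X k else 0) := by
    intro j k
    rw [pderiv_mul, pderiv_X, pderiv_X, Pi.single_apply, Pi.single_apply]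
    simp only [eq_comm (b := i)]
    split_ifs <;> ring
  rw [KillingProlongation.pderiv_hamiltonianPoly]
  simp only [e, Finset.sum_add_distrib, Finset.sum_ite_eq, Finset.mem_univ, if_true]
  rw [Finset.sum_comm (f := fun j k => if i = j then C (1 / 2 * (G x)⁻¹ j k) * X k else 0)]
  simp only [Finset.sum_ite_eq, Finset.mem_univ, if_true, ← Finset.sum_add_distrib, linForm]
  refine Finset.sum_congr rfl fun j _ => ?_
  rw [hG.symm_inv hx j i, ← add_mul, ← C_add]
  congr 2
  ring

lemma IsMetricOn.smoothJet_killingEquation (hG : IsMetricOn G U) (τ : MultiEq n (d + 1)) :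
    SmoothJet U (killingEquation G d τ) := by
  intro I α
  unfold killingEquation
  refine ContDiffOn.sub (ContDiffOn.sum fun i _ => ?_) ?_
  · by_cases h : α = Finsupp.single i 1
    · simp only [h, if_true, KillingProlongation.pderiv_hamiltonianPoly, Finset.sum_mul, coeff_sum,
        mul_assoc, coeff_C_mul]
      exact ContDiffOn.sum fun j _ => ContDiffOn.sum fun k _ =>
        contDiffOn_const.mul ((hG.contDiffOn_inv j k).mul contDiffOn_const)
    · simpa only [h, if_false] using contDiffOn_const
  · by_cases h : α = 0
    · simp only [h, if_true, hamiltonianPolyDx, Finset.sum_mul, coeff_sum, mul_assoc, coeff_C_mul]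
      exact ContDiffOn.sum fun i _ => ContDiffOn.sum fun j _ => ContDiffOn.sum fun k _ =>
        (contDiffOn_pd hG.isOpen (contDiffOn_const.mul (hG.contDiffOn_inv j k)) i).mul
          contDiffOn_const
    · simpa only [h, if_false] using contDiffOn_const

lemma orderLE_killingEquation (τ : MultiEq n (d + 1)) (U : Set (Coord n)) :
    OrderLE U (0 + 1) (killingEquation G d τ) := by
  intro I α hα x _
  have h0 : α ≠ 0 := by
    rintro rfl
    simp at hα
  have h1 : ∀ i, α ≠ Finsupp.single i 1 := by
    rintro i rfl
    simp at hα
  simp [killingEquation, h0, h1]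

lemma IsMetricOn.orderLE_iterOp (hG : IsMetricOn G U) (τ : MultiEq n (d + 1)) {k : ℕ}
    {β : Fin n →₀ ℕ} (hβ : β.degree ≤ k) :
    OrderLE U (k + 1) (iterOp totalDeriv β (killingEquation G d τ)) :=
  ((orderLE_killingEquation τ U).iterOp hG.isOpen (hG.smoothJet_killingEquation τ)
    rfl).mono (by omega)

/-- The index of the variable `a^I`. -/
def idxZero (I : MultiEq n d) : JetIdx n d (0 + 1) := (I, ⟨0, by simp⟩)

/-- The index of the variable `a^I_{1_i}`. -/
noncomputable def idxOne (I : MultiEq n d) (i : Fin n) : JetIdx n d (0 + 1) :=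
  (I, ⟨Finsupp.single i 1, by simp⟩)

/-- The polynomial `∑_{|I| = d} a^I p^I`. -/
noncomputable def momentumMv (a : MultiEq n d → ℝ) : MvPolynomial (Fin n) ℝ :=
  ∑ I, monomial I.1 (a I)

/-- The bracket `{H, I_d}` at `x` as a polynomial in the momenta, for the `1`-jet `y` of the
coefficients of `I_d`. -/
noncomputable def killingPoly (G : Coord n → Matrix (Fin n) (Fin n) ℝ) (x : Coord n)
    (y : JetIdx n d (0 + 1) → ℝ) : MvPolynomial (Fin n) ℝ :=
  ∑ i, (pderiv i (hamiltonianPoly G x) * momentumMv (fun I => y (idxOne I i))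
    - hamiltonianPolyDx G i x * pderiv i (momentumMv fun I => y (idxZero I)))

lemma coeff_momentumMv (a : MultiEq n d → ℝ) (I : MultiEq n d) :
    coeff I.1 (momentumMv a) = a I := by
  rw [momentumMv, coeff_sum, Finset.sum_eq_single I]
  · simp
  · intro J _ hJ
    rw [coeff_monomial, if_neg fun h => hJ (Subtype.ext h)]
  · simp

lemma isHomogeneous_momentumMv (a : MultiEq n d → ℝ) : (momentumMv a).IsHomogeneous d :=
  IsHomogeneous.sum _ _ _ fun I _ => isHomogeneous_monomial _ I.2

lemma monomial_eq_C_mul_one (α : Fin n →₀ ℕ) (c : ℝ) :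
    monomial α c = C c * monomial α (1 : ℝ) := by
  rw [C_mul_monomial, mul_one]

lemma evalJet_killingEquation (x : Coord n) (y : JetIdx n d (0 + 1) → ℝ) (τ : MultiEq n (d + 1)) :
    evalJet (killingEquation G d τ) y x = coeff τ.1 (killingPoly G x y) := by
  have h1 : ∀ I : MultiEq n d, ∑ α : MultiLE n (0 + 1), killingEquation G d τ I α.1 x * y (I, α)
      = ∑ i, (coeff τ.1 (pderiv i (hamiltonianPoly G x) * monomial I.1 1) * y (idxOne I i)
        - coeff τ.1 (hamiltonianPolyDx G i x * pderiv i (monomial I.1 1)) * y (idxZero I)) := by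
    intro I
    simp only [killingEquation, sub_mul, Finset.sum_mul, ite_mul, zero_mul, Finset.sum_sub_distrib]
    congr 1
    · rw [Finset.sum_comm]
      refine Finset.sum_congr rfl fun i _ => ?_
      rw [Finset.sum_eq_single (idxOne I i).2]
      · simp [idxOne]
      · intro α _ hα
        exact if_neg fun h => hα (Subtype.ext h)
      · simp
    · rw [Finset.sum_eq_single (idxZero I).2]
      · simp [idxZero]
      · intro α _ hα
        exact if_neg fun h => hα (Subtype.ext h)
      · simp
  rw [evalJet, Fintype.sum_prod_type]
  simp only [h1]
  rw [Finset.sum_comm, killingPoly, coeff_sum]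
  refine Finset.sum_congr rfl fun i _ => ?_
  rw [coeff_sub, momentumMv, momentumMv, map_sum, Finset.mul_sum, Finset.mul_sum, coeff_sum,
    coeff_sum, ← Finset.sum_sub_distrib]
  refine Finset.sum_congr rfl fun I _ => ?_
  rw [monomial_eq_C_mul_one I.1 (y (idxOne I i)), monomial_eq_C_mul_one I.1 (y (idxZero I)),
    pderiv_C_mul, mul_left_comm, coeff_C_mul, mul_left_comm, coeff_C_mul]
  ring

lemma isHomogeneous_quadratic (g : Fin n → Fin n → ℝ) :
    (∑ j, ∑ k, C (g j k) * X j * X k : MvPolynomial (Fin n) ℝ).IsHomogeneous 2 :=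
  IsHomogeneous.sum _ _ _ fun j _ => IsHomogeneous.sum _ _ _ fun k _ =>
    (isHomogeneous_C_mul_X (g j k) j).mul (isHomogeneous_X ℝ k)

lemma isHomogeneous_killingPoly (x : Coord n) (y : JetIdx n d (0 + 1) → ℝ) :
    (killingPoly G x y).IsHomogeneous (d + 1) := by
  refine IsHomogeneous.sum _ _ _ fun i _ => IsHomogeneous.sub ?_ ?_
  · have h1 : (pderiv i (hamiltonianPoly G x)).IsHomogeneous 1 :=
      (isHomogeneous_quadratic _).pderiv
    rw [add_comm]
    exact h1.mul (isHomogeneous_momentumMv _)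
  · have h1 : (hamiltonianPolyDx G i x).IsHomogeneous 2 := isHomogeneous_quadratic _
    have h2 := isHomogeneous_momentumMv (fun I => y (idxZero I))
    -- For `d = 0` the degree `d - 1` does not exist, but then the momentum polynomial is constant
    -- and its derivative is zero.
    rcases d with - | d
    · have h3 := (totalDegree_zero_iff_isHomogeneous _).2 h2
      rw [totalDegree_eq_zero_iff_eq_C] at h3
      rw [h3, pderiv_C, mul_zero]
      exact isHomogeneous_zero _ _ _
    · have h3 : (pderiv i (momentumMv fun I => y (idxZero I))).IsHomogeneous d := h2.pderiv
      have h4 := h1.mul h3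
      rwa [show 2 + d = d + 1 + 1 by omega] at h4

/-- By homogeneity the coefficients in degree `d + 1` are all there are. -/
lemma killingPoly_eq_zero_iff (x : Coord n) (y : JetIdx n d (0 + 1) → ℝ) :
    killingPoly G x y = 0 ↔ ∀ τ : MultiEq n (d + 1), evalJet (killingEquation G d τ) y x = 0 := by
  constructor
  · intro h τ
    rw [evalJet_killingEquation, h, coeff_zero]
  · intro h
    ext τ
    rw [coeff_zero]
    by_cases hτ : τ.degree = d + 1
    · rw [← h ⟨τ, hτ⟩, evalJet_killingEquation]
    · exact (isHomogeneous_killingPoly x y).coeff_eq_zero hτ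

/-! ### The Poisson bracket -/

lemma hasFDerivAt_pd {f : Coord n → ℝ} {x : Coord n} {f' : Coord n →L[ℝ] ℝ}
    (h : HasFDerivAt f f' x) (i : Fin n) : pd i f x = f' (EuclideanSpace.single i 1) := by
  rw [pd, h.fderiv]

lemma pd_sum_mul {ι : Type*} (s : Finset ι) {f : ι → Coord n → ℝ} (c : ι → ℝ) {x : Coord n}
    (hf : ∀ j ∈ s, DifferentiableAt ℝ (f j) x) (i : Fin n) :
    pd i (fun y => ∑ j ∈ s, f j y * c j) x = ∑ j ∈ s, pd i (f j) x * c j := by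
  rw [hasFDerivAt_pd (HasFDerivAt.fun_sum fun j hj => (hf j hj).hasFDerivAt.mul_const (c j)) i]
  simp [pd, mul_comm]

lemma differentiable_eval (f : MvPolynomial (Fin n) ℝ) :
    Differentiable ℝ (fun p : Coord n => eval (p : Fin n → ℝ) f) := by
  induction f using MvPolynomial.induction_on with
  | C c => simp
  | add f g hf hg =>
    simp only [map_add]
    exact hf.add hg
  | mul_X f j hf =>
    simp only [map_mul, eval_X]
    fun_prop

lemma pd_eval (f : MvPolynomial (Fin n) ℝ) (i : Fin n) (p : Coord n) :
    pd i (fun p : Coord n => eval (p : Fin n → ℝ) f) p = eval (p : Fin n → ℝ) (pderiv i f) := by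
  induction f using MvPolynomial.induction_on with
  | C c => simp [pd]
  | add f g hf hg =>
    simp only [map_add]
    rw [pd_add (differentiable_eval f p) (differentiable_eval g p), hf, hg]
  | mul_X f j hf =>
    simp only [map_mul, eval_X]
    have h1 := ((differentiable_eval f p).hasFDerivAt).mul
      ((EuclideanSpace.proj j : Coord n →L[ℝ] ℝ).hasFDerivAt (x := p))
    have h2 := hasFDerivAt_pd h1 i
    have h3 : pd i (fun p : Coord n => eval (p : Fin n → ℝ) f * p j) p
        = eval (p : Fin n → ℝ) f * (if j = i then 1 else 0)
          + p j * pd i (fun p : Coord n => eval (p : Fin n → ℝ) f) p := by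
      refine h2.trans ?_
      simp [pd]
    rw [h3, hf, pderiv_mul, pderiv_X, map_add, map_mul, map_mul, eval_X, Pi.single_apply]
    split_ifs with h <;> simp [mul_comm, add_comm]

lemma eval_momentumMv (a : MultiEq n d → Coord n → ℝ) (x p : Coord n) :
    momentumPoly a x p = eval (p : Fin n → ℝ) (momentumMv fun I => a I x) := by
  rw [momentumPoly, momentumMv, map_sum]
  refine Finset.sum_congr rfl fun I _ => ?_
  rw [eval_monomial, Finsupp.prod_fintype _ _ (by simp)]

lemma eval_hamiltonianPoly (x p : Coord n) :
    hamiltonian G x p = eval (p : Fin n → ℝ) (hamiltonianPoly G x) := by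
  simp only [hamiltonian, hamiltonianPoly, map_sum, map_mul, eval_C, eval_X, Finset.mul_sum,
    mul_assoc]

lemma pd_momentumPoly {a : MultiEq n d → Coord n → ℝ} {x : Coord n}
    (ha : ∀ I, DifferentiableAt ℝ (a I) x) (p : Coord n) (i : Fin n) :
    pd i (fun y => momentumPoly a y p) x
      = eval (p : Fin n → ℝ) (momentumMv fun I => pd i (a I) x) := by
  have := eval_momentumMv (fun I y => pd i (a I) y) x p
  rw [← this]
  exact pd_sum_mul Finset.univ _ (fun I _ => ha I) i

lemma pd_hamiltonian {x : Coord n} (hG : ∀ j k, DifferentiableAt ℝ (fun y => (G y)⁻¹ j k) x)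
    (p : Coord n) (i : Fin n) :
    pd i (fun y => hamiltonian G y p) x = eval (p : Fin n → ℝ) (hamiltonianPolyDx G i x) := by
  have e : (fun y => hamiltonian G y p)
      = fun y => ∑ jk : Fin n × Fin n, (1 / 2 * (G y)⁻¹ jk.1 jk.2) * (p jk.1 * p jk.2) := by
    ext y
    rw [Fintype.sum_prod_type, hamiltonian, Finset.mul_sum]
    refine Finset.sum_congr rfl fun j _ => ?_
    rw [Finset.mul_sum]
    exact Finset.sum_congr rfl fun k _ => by ring
  rw [e, pd_sum_mul Finset.univ _ (fun jk _ => (hG jk.1 jk.2).const_mul _) i,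
    Fintype.sum_prod_type]
  simp only [hamiltonianPolyDx, map_sum, map_mul, eval_C, eval_X, mul_assoc]

lemma IsMetricOn.poissonBracket_eq (hG : IsMetricOn G U) {x : Coord n} (hx : x ∈ U)
    {V : Set (Coord n)} (hV : IsOpen V) (hxV : x ∈ V) {a : MultiEq n d → Coord n → ℝ}
    (ha : ∀ I, ContDiffOn ℝ ∞ (a I) V) (p : Coord n) :
    poissonBracket (hamiltonian G) (momentumPoly a) x p
      = eval (p : Fin n → ℝ) (killingPoly G x (jetAt 0 a x)) := by
  have ha' : ∀ I, DifferentiableAt ℝ (a I) x := fun I =>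
    differentiableAt_of_smoothOn (ha I) hV hxV
  have hG' : ∀ j k, DifferentiableAt ℝ (fun y => (G y)⁻¹ j k) x := fun j k =>
    differentiableAt_of_smoothOn (hG.contDiffOn_inv j k) hG.isOpen hx
  have e0 : ∀ I, jetAt 0 a x (idxZero I) = a I x := fun I => by simp [jetAt, idxZero]
  have e1 : ∀ I i, jetAt 0 a x (idxOne I i) = pd i (a I) x := fun I i => by
    have := (commuteUpTo_pd hV).iterOp_add_single 0 i (ha I) hxV
    rwa [zero_add, iterOp_zero] at this
  rw [poissonBracket, killingPoly, map_sum]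
  refine Finset.sum_congr rfl fun i _ => ?_
  rw [pd_momentumPoly ha', pd_hamiltonian hG', map_sub, map_mul, map_mul]
  simp only [e0, e1]
  rw [← pd_eval, ← pd_eval]
  simp only [eval_hamiltonianPoly, eval_momentumMv]

lemma IsMetricOn.poissonBracket_eq_zero_iff (hG : IsMetricOn G U) {x : Coord n} (hx : x ∈ U)
    {V : Set (Coord n)} (hV : IsOpen V) (hxV : x ∈ V) {a : MultiEq n d → Coord n → ℝ}
    (ha : ∀ I, ContDiffOn ℝ ∞ (a I) V) :
    (∀ p, poissonBracket (hamiltonian G) (momentumPoly a) x p = 0) ↔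
      ∀ τ : MultiEq n (d + 1), evalJet (killingEquation G d τ) (jetAt 0 a x) x = 0 := by
  rw [← killingPoly_eq_zero_iff]
  constructor
  · intro h
    -- Vanishing for all momenta means vanishing of a polynomial function on `ℝⁿ`, hence of its
    -- coefficients.
    refine MvPolynomial.funext fun p => ?_
    have := h (WithLp.toLp 2 p)
    rw [hG.poissonBracket_eq hx hV hxV ha] at this
    rw [map_zero]
    exact this
  · intro h p
    rw [hG.poissonBracket_eq hx hV hxV ha, h, map_zero]

end KillingPoly

/-! ### The prolongations as a linear system -/

section Prolongation

set_option maxSynthPendingDepth 3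

variable {n d : ℕ} {G : Coord n → Matrix (Fin n) (Fin n) ℝ} {U : Set (Coord n)}

lemma mulVec_prolongationMatrix (G : Coord n → Matrix (Fin n) (Fin n) ℝ) (k : ℕ) (x : Coord n)
    (ξ : JetVar n d k → ℝ) (τ : MultiEq n (d + 1)) (β : MultiLE n k) :
    (prolongationMatrix G d k x).mulVec ξ (τ, β)
      = evalJet (iterOp totalDeriv β.1 (killingEquation G d τ)) ξ x := rfl

lemma evalJet_congr {F F' : LinJet n d} (h : EqJet U F F') {x : Coord n} (hx : x ∈ U) {m : ℕ}
    (ξ : JetIdx n d m → ℝ) : evalJet F ξ x = evalJet F' ξ x :=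
  Finset.sum_congr rfl fun v _ => by rw [h v.1 v.2.1 hx]

lemma IsMetricOn.evalJet_add_single (hG : IsMetricOn G U) {x : Coord n} (hx : x ∈ U)
    (τ : MultiEq n (d + 1)) {k : ℕ} {β : Fin n →₀ ℕ} (hβ : β.degree ≤ k) (q : Fin n)
    (ξ : JetVar n d (k + 1) → ℝ) :
    evalJet (iterOp totalDeriv (β + Finsupp.single q 1) (killingEquation G d τ)) ξ x
      = evalJet (fun I α => pd q (iterOp totalDeriv β (killingEquation G d τ) I α))
          (truncL n d (k + 1) ξ) x
        + evalJet (iterOp totalDeriv β (killingEquation G d τ)) (shiftL q ξ) x := by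
  rw [evalJet_congr ((commuteUpTo_totalDeriv hG.isOpen).iterOp_add_single β q
    (hG.smoothJet_killingEquation τ)) hx]
  exact evalJet_totalDeriv hG.isOpen (hG.orderLE_iterOp τ hβ) hx q ξ

lemma IsMetricOn.evalJet_trunc (hG : IsMetricOn G U) {x : Coord n} (hx : x ∈ U)
    (τ : MultiEq n (d + 1)) {k : ℕ} {β : Fin n →₀ ℕ} (hβ : β.degree ≤ k)
    (ξ : JetVar n d (k + 1) → ℝ) :
    evalJet (iterOp totalDeriv β (killingEquation G d τ)) ξ x
      = evalJet (iterOp totalDeriv β (killingEquation G d τ)) (truncL n d (k + 1) ξ) x :=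
  evalJet_incl (hG.orderLE_iterOp τ hβ) hx ξ

lemma IsMetricOn.truncL_mem (hG : IsMetricOn G U) {x : Coord n} (hx : x ∈ U) {k : ℕ}
    {ξ : JetVar n d (k + 1) → ℝ} (hξ : (prolongationMatrix G d (k + 1) x).mulVec ξ = 0) :
    (prolongationMatrix G d k x).mulVec (truncL n d (k + 1) ξ) = 0 := by
  ext ⟨τ, β⟩
  rw [mulVec_prolongationMatrix, ← hG.evalJet_trunc hx τ β.2]
  exact congrFun hξ (τ, ⟨β.1, β.2.trans (Nat.le_succ _)⟩)

/-- The indices of the variables `a^I_{α + β}` with `|α| ≤ 1`. -/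
noncomputable def addIdx {k : ℕ} (β : Fin n →₀ ℕ) (hβ : β.degree = k) (v : JetIdx n d (0 + 1)) :
    JetIdx n d (k + 1) :=
  (v.1, ⟨v.2.1 + β, by
    have := v.2.2
    rw [map_add]
    omega⟩)

/-- On jets without lower order part each total derivative acts by its shift alone, since the terms
with differentiated coefficients see only the zero truncation. What remains is the symbol. -/
lemma IsMetricOn.evalJet_top (hG : IsMetricOn G U) {x : Coord n} (hx : x ∈ U)
    (τ : MultiEq n (d + 1)) {k : ℕ} {β : Fin n →₀ ℕ} (hβ : β.degree = k) (ξ : JetVar n d k → ℝ)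
    (hξ : truncL n d k ξ = 0) :
    evalJet (iterOp totalDeriv β (killingEquation G d τ)) ξ x
      = evalJet (killingEquation G d τ) (fun v => ξ (addIdx β hβ v)) x := by
  induction k generalizing β with
  | zero =>
    obtain rfl := (Finsupp.degree_eq_zero_iff β).1 hβ
    rw [iterOp_zero]
    simp [addIdx]
  | succ k ih =>
    obtain ⟨β', q, rfl, hβ'⟩ := exists_eq_add_single hβ
    have h0 : truncL n d k (shiftL q ξ) = 0 := by
      ext v
      exact congrFun hξ (shiftIdx q v)
    rw [hG.evalJet_add_single hx τ hβ'.le q ξ, hξ, ih hβ' _ h0]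
    have e : ∀ v : JetIdx n d (0 + 1),
        shiftIdx q (addIdx β' hβ' v) = addIdx (β' + Finsupp.single q 1) hβ v := fun v => by
      simp only [addIdx, shiftIdx, add_assoc]
    simp only [shiftL_apply, e]
    simp [evalJet]

/-- Beyond order `d` a solution of the prolongation is determined by its lower order part. -/
lemma IsMetricOn.eq_zero_of_truncL_eq_zero (hG : IsMetricOn G U) {x : Coord n} (hx : x ∈ U) {k : ℕ}
    (hk : d ≤ k) {ξ : JetVar n d k → ℝ} (hξ : (prolongationMatrix G d k x).mulVec ξ = 0)
    (h0 : truncL n d k ξ = 0) : ξ = 0 := by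
  -- For fixed `α` the components `a^I_α` form a polynomial of degree at most `d` in the momenta.
  -- Multi-indices beyond the order of the jet get the harmless value `0`.
  set P : (Fin n →₀ ℕ) → MvPolynomial (Fin n) ℝ := fun α =>
    if h : α.degree ≤ k + 1 then momentumMv fun I => ξ (I, ⟨α, h⟩) else 0 with hP
  have hdeg : ∀ α, (P α).totalDegree ≤ d := fun α => by
    by_cases h : α.degree ≤ k + 1
    · simpa only [hP, h, dif_pos] using (isHomogeneous_momentumMv _).totalDegree_le
    · simp [hP, h]
  have hlow : ∀ v : JetVar n d k, v.2.1.degree ≤ k → ξ v = 0 := fun v hv =>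
    congrFun h0 (v.1, ⟨v.2.1, hv⟩)
  have hrel : ∀ β : Fin n →₀ ℕ, β.degree = k →
      ∑ i, P (β + Finsupp.single i 1) * linForm ((G x)⁻¹ i) = 0 := by
    intro β hβ
    have h1 : killingPoly G x (fun v : JetIdx n d (0 + 1) => ξ (addIdx β hβ v)) = 0 := by
      rw [killingPoly_eq_zero_iff]
      intro τ
      rw [← hG.evalJet_top hx τ hβ ξ h0]
      exact congrFun hξ (τ, ⟨β, hβ.le⟩)
    rw [← h1, killingPoly]
    refine Finset.sum_congr rfl fun i _ => ?_
    have e0 : ∀ I : MultiEq n d, ξ (addIdx β hβ (idxZero I)) = 0 := fun I =>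
      hlow _ (by simp [addIdx, idxZero, hβ])
    have e1 : P (β + Finsupp.single i 1)
        = momentumMv fun I => ξ (addIdx β hβ (idxOne I i)) := by
      have hd : (Finsupp.single i 1 + β).degree ≤ k + 1 := by
        rw [map_add, Finsupp.degree_single, hβ, add_comm]
      rw [add_comm β]
      exact dif_pos hd
    have e2 : (momentumMv fun _ : MultiEq n d => (0 : ℝ)) = 0 := by simp [momentumMv]
    simp only [e0, e1, e2, map_zero, mul_zero, sub_zero, hG.pderiv_hamiltonianPoly hx]
    ring
  have hA : IsUnit (G x)⁻¹ := (Matrix.isUnit_nonsing_inv_iff).2 (hG.isUnit x hx)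
  ext ⟨I, α, hα⟩
  rcases hα.lt_or_eq with hlt | heq
  · exact hlow _ (Nat.lt_succ_iff.1 hlt)
  · have h1 := symbol_injective (Nat.lt_succ_iff.2 hk) hA hdeg hrel heq
    have h2 := congrArg (MvPolynomial.coeff I.1) h1
    simp only [hP, hα, dif_pos, coeff_momentumMv, MvPolynomial.coeff_zero] at h2
    exact h2

/-! ### Matrix functions as smooth families of linear maps, and local constancy of rank. -/

/-- A matrix as a continuous linear map. -/
noncomputable def matCLM {R C : Type*} [Fintype R] [Fintype C] (A : Matrix R C ℝ) :
    (C → ℝ) →L[ℝ] (R → ℝ) :=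
  LinearMap.toContinuousLinearMap A.mulVecLin

@[simp]
lemma matCLM_apply {R C : Type*} [Fintype R] [Fintype C] (A : Matrix R C ℝ) (ξ : C → ℝ) :
    matCLM A ξ = A.mulVec ξ := rfl

lemma matCLM_eq_sum {R C : Type*} [Fintype R] [Fintype C] [DecidableEq R] (A : Matrix R C ℝ) :
    matCLM A = ∑ r, ∑ c, A r c • (ContinuousLinearMap.proj c : (C → ℝ) →L[ℝ] ℝ).smulRight
      (Pi.single r (1 : ℝ) : R → ℝ) := by
  ext1 ξ
  ext r
  simp [Matrix.mulVec, dotProduct, Finset.sum_apply, Pi.single_apply]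

lemma contDiffOn_matCLM {R C : Type*} [Fintype R] [Fintype C] {A : Coord n → Matrix R C ℝ}
    (hA : ∀ r c, ContDiffOn ℝ ∞ (fun x => A x r c) U) : ContDiffOn ℝ ∞ (fun x => matCLM (A x)) U := by
  classical
  simp only [matCLM_eq_sum]
  exact ContDiffOn.sum fun r _ => ContDiffOn.sum fun c _ => (hA r c).smul contDiffOn_const

lemma fderiv_matCLM {R C : Type*} [Fintype R] [Fintype C] {A : Coord n → Matrix R C ℝ}
    {x : Coord n} (hA : ∀ r c, DifferentiableAt ℝ (fun y => A y r c) x) (v : Coord n) :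
    fderiv ℝ (fun y => matCLM (A y)) x v
      = matCLM (Matrix.of fun r c => fderiv ℝ (fun y => A y r c) x v) := by
  classical
  have h : HasFDerivAt (fun y => matCLM (A y)) (∑ r, ∑ c, (fderiv ℝ (fun y => A y r c) x).smulRight
      ((ContinuousLinearMap.proj c : (C → ℝ) →L[ℝ] ℝ).smulRight (Pi.single r (1 : ℝ) : R → ℝ))) x := by
    simp only [matCLM_eq_sum]
    exact HasFDerivAt.fun_sum fun r _ => HasFDerivAt.fun_sum fun c _ =>
      (hA r c).hasFDerivAt.smul_const _
  rw [h.fderiv, matCLM_eq_sum]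
  simp

lemma finrank_ker_matCLM {R C : Type*} [Fintype R] [Fintype C] (A : Matrix R C ℝ) :
    Module.finrank ℝ (matCLM A).ker = Fintype.card C - A.rank := by
  have h := A.mulVecLin.finrank_range_add_finrank_ker
  rw [Module.finrank_fintype_fun_eq_card] at h
  have h2 : A.rank = Module.finrank ℝ A.mulVecLin.range := rfl
  rw [← h, h2, Nat.add_sub_cancel_left]
  rfl

/-- Lower semicontinuity of the rank: composed with a right inverse of `f x₀` on its range, `f x` is
injective at `x₀`, and injectivity is an open condition. -/
lemma eventually_finrank_range_le {X E F : Type*} [TopologicalSpace X]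
    [NormedAddCommGroup E] [NormedSpace ℝ E] [FiniteDimensional ℝ E]
    [NormedAddCommGroup F] [NormedSpace ℝ F] [FiniteDimensional ℝ F]
    {f : X → E →L[ℝ] F} {x₀ : X} (hf : ContinuousAt f x₀) :
    ∀ᶠ x in 𝓝 x₀, Module.finrank ℝ (f x₀).range ≤ Module.finrank ℝ (f x).range := by
  obtain ⟨s, hs⟩ := ((f x₀ : E →ₗ[ℝ] F).rangeRestrict).exists_rightInverse_of_surjective
    (LinearMap.range_rangeRestrict _)
  set s' : (f x₀).range →L[ℝ] E := LinearMap.toContinuousLinearMap s with hs'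
  have h0 : Function.Injective (f x₀ ∘L s') := by
    intro a b hab
    have h1 : ∀ a, f x₀ (s' a) = a := fun a => congrArg Subtype.val (LinearMap.congr_fun hs a)
    have h2 : f x₀ (s' a) = f x₀ (s' b) := hab
    rw [h1, h1] at h2
    exact Subtype.ext h2
  have hc : ContinuousAt (fun x => f x ∘L s') x₀ := hf.clm_comp continuousAt_const
  have hev := hc.eventually_mem (ContinuousLinearMap.isOpen_injective.mem_nhds h0)
  filter_upwards [hev] with x hx
  rw [← LinearMap.finrank_range_of_inj (f := ((f x ∘L s' : _ →L[ℝ] F) : _ →ₗ[ℝ] F)) hx]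
  refine Submodule.finrank_mono ?_
  rintro _ ⟨a, rfl⟩
  exact ⟨s' a, rfl⟩

lemma IsMetricOn.smooth_prolongationMatrix (hG : IsMetricOn G U) (k : ℕ)
    (r : MultiEq n (d + 1) × MultiLE n k) (c : JetVar n d k) :
    ContDiffOn ℝ ∞ (fun x => prolongationMatrix G d k x r c) U :=
  ((commuteUpTo_totalDeriv hG.isOpen).mem_iterOp r.2.1 (hG.smoothJet_killingEquation r.1)) c.1 c.2.1

/-- Semicontinuity gives one inequality near `x₀`, maximality at `x₀` the other. -/
lemma IsMetricOn.eventually_rank_eq (hG : IsMetricOn G U) {x₀ : Coord n} (hx₀ : x₀ ∈ U) {k : ℕ}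
    (hreg : ∀ x ∈ U, (prolongationMatrix G d k x).rank ≤ (prolongationMatrix G d k x₀).rank) :
    ∀ᶠ x in 𝓝 x₀, (prolongationMatrix G d k x).rank = (prolongationMatrix G d k x₀).rank := by
  have hc : ContinuousAt (fun x => matCLM (prolongationMatrix G d k x)) x₀ :=
    ((contDiffOn_matCLM (hG.smooth_prolongationMatrix k)).contDiffAt
      (hG.isOpen.mem_nhds hx₀)).continuousAt
  filter_upwards [eventually_finrank_range_le hc, hG.isOpen.eventually_mem hx₀] with x h1 h2
  exact le_antisymm (hreg x h2) h1

lemma fderiv_eq_sum_pd {f : Coord n → ℝ} (x w : Coord n) :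
    fderiv ℝ f x w = ∑ q, w q * pd q f x := by
  conv_lhs => rw [coord_eq_sum w]
  simp [pd]

/-- For `|β| ≤ k` the equations `D_{β + 1_q} F_τ = 0` belong to level `k + 1`. By the product rule
for total derivatives each is one component of the claim; the direction `w` is their combination
with weights `w q`. -/
lemma IsMetricOn.tangent (hG : IsMetricOn G U) {x : Coord n} (hx : x ∈ U) {k : ℕ}
    {ξ : JetVar n d (k + 1) → ℝ} (hξ : (prolongationMatrix G d (k + 1) x).mulVec ξ = 0)
    (w : Coord n) :
    matCLM (prolongationMatrix G d k x) (dirShift n d (k + 1) w ξ)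
      + fderiv ℝ (fun y => matCLM (prolongationMatrix G d k y)) x w (truncL n d (k + 1) ξ) = 0 := by
  rw [fderiv_matCLM fun r c => differentiableAt_of_smoothOn (hG.smooth_prolongationMatrix k r c)
    hG.isOpen hx, dirShift_apply, map_sum]
  ext ⟨τ, β⟩
  have h1 : ∀ q, evalJet (fun I α => pd q (iterOp totalDeriv β.1 (killingEquation G d τ) I α))
          (truncL n d (k + 1) ξ) x
        + evalJet (iterOp totalDeriv β.1 (killingEquation G d τ)) (shiftL q ξ) x = 0 := fun q => by
    rw [← hG.evalJet_add_single hx τ β.2 q ξ]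
    exact congrFun hξ (τ, ⟨β.1 + Finsupp.single q 1, by
      rw [map_add, Finsupp.degree_single]; exact Nat.succ_le_succ β.2⟩)
  have h2 : matCLM (Matrix.of fun r c => fderiv ℝ (fun y => prolongationMatrix G d k y r c) x w)
      (truncL n d (k + 1) ξ) (τ, β)
      = ∑ q, w q * evalJet (fun I α => pd q (iterOp totalDeriv β.1 (killingEquation G d τ) I α))
          (truncL n d (k + 1) ξ) x := by
    simp only [matCLM_apply, Matrix.mulVec, dotProduct, Matrix.of_apply, fderiv_eq_sum_pd,
      evalJet, Finset.mul_sum, Finset.sum_mul]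
    rw [Finset.sum_comm]
    refine Finset.sum_congr rfl fun q _ => Finset.sum_congr rfl fun c _ => ?_
    rw [mul_assoc]
    rfl
  rw [Pi.add_apply, h2, Finset.sum_apply, ← Finset.sum_add_distrib, Pi.zero_apply]
  refine Finset.sum_eq_zero fun q _ => ?_
  have h3 : matCLM (prolongationMatrix G d k x) (w q • shiftL q ξ) (τ, β)
      = w q * evalJet (iterOp totalDeriv β.1 (killingEquation G d τ)) (shiftL q ξ) x := by
    rw [map_smul]
    rfl
  rw [h3, ← mul_add, add_comm, h1, mul_zero]

/-- Near a regular point at which two consecutive prolongations have solution spaces of the same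
dimension, they form a linear system of finite type. -/
theorem IsMetricOn.exists_finiteTypeSystem (hG : IsMetricOn G U) {x₀ : Coord n} (hx₀ : x₀ ∈ U)
    (hreg : ∀ k, ∀ x ∈ U,
      (prolongationMatrix G d k x).rank ≤ (prolongationMatrix G d k x₀).rank) {k : ℕ} (hk : d ≤ k)
    (hδ : corank G d x₀ (k + 1) = corank G d x₀ k) :
    ∃ U' ⊆ U, x₀ ∈ U' ∧ FiniteTypeSystem U' (fun x => matCLM (prolongationMatrix G d (k + 1) x))
      (fun x => matCLM (prolongationMatrix G d k x)) (truncL n d (k + 1)) (dirShift n d (k + 1))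
      (truncL n d k) (dirShift n d k) (corank G d x₀ k) := by
  obtain ⟨U', hU', hU'o, hxU'⟩ := eventually_nhds_iff.1
    ((hG.eventually_rank_eq hx₀ (hreg (k + 1))).and
      ((hG.eventually_rank_eq hx₀ (hreg k)).and (hG.isOpen.eventually_mem hx₀)))
  have hsub : U' ⊆ U := fun x hx => (hU' x hx).2.2
  refine ⟨U', hsub, hxU', hU'o, (contDiffOn_matCLM (hG.smooth_prolongationMatrix _)).mono hsub,
    (contDiffOn_matCLM (hG.smooth_prolongationMatrix _)).mono hsub,
    fun x hx ξ hξ => hG.truncL_mem (hsub hx) hξ,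
    fun x hx ξ hξ h0 => hG.eq_zero_of_truncL_eq_zero (hsub hx) (hk.trans (Nat.le_succ k)) hξ h0,
    fun x hx s hs h0 => hG.eq_zero_of_truncL_eq_zero (hsub hx) hk hs h0,
    fun x hx ξ hξ w => hG.tangent (hsub hx) hξ w, fun v ξ => truncL_dirShift v ξ,
    fun v w ξ => dirShift_comm v w ξ, fun x hx => ?_, fun x hx => ?_⟩
  · rw [finrank_ker_matCLM, (hU' x hx).1, ← hδ, corank]
  · rw [finrank_ker_matCLM, (hU' x hx).2.1, corank]

end Prolongation

/-! ### Jets of Killing tensors -/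

section KillingJets

set_option maxSynthPendingDepth 3

variable {n d : ℕ} {G : Coord n → Matrix (Fin n) (Fin n) ℝ} {U V : Set (Coord n)}
  {a b : MultiEq n d → Coord n → ℝ}

lemma dirShift_single {m : ℕ} (q : Fin n) (ξ : JetIdx n d (m + 1) → ℝ) :
    dirShift n d m (EuclideanSpace.single q 1) ξ = shiftL q ξ := by
  rw [dirShift_apply, Finset.sum_eq_single q]
  · simp
  · intro r _ hr
    simp [hr]
  · simp

lemma hasFDerivAt_jetAt (hV : IsOpen V) (ha : ∀ I, ContDiffOn ℝ ∞ (a I) V) (k : ℕ) {x : Coord n}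
    (hx : x ∈ V) :
    HasFDerivAt (fun y => jetAt k a y) ((dirShift n d (k + 1)).flip (jetAt (k + 1) a x)) x := by
  rw [hasFDerivAt_pi']
  intro v
  have hs : ContDiffOn ℝ ∞ (iterOp pd v.2.1 (a v.1)) V :=
    (commuteUpTo_pd hV).mem_iterOp v.2.1 (ha v.1)
  refine (differentiableAt_of_smoothOn hs hV hx).hasFDerivAt.congr_fderiv ?_
  ext1 w
  have e : ∀ q, jetAt (k + 1) a x (shiftIdx q v) = pd q (iterOp pd v.2.1 (a v.1)) x := fun q =>
    (commuteUpTo_pd hV).iterOp_add_single v.2.1 q (ha v.1) hx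
  rw [fderiv_eq_sum_pd]
  simp [dirShift_apply, e]

/-- A total derivative evaluated on the jet of a function is the derivative of the evaluated
expression, so each prolonged equation follows by differentiating one of lower order. -/
lemma IsMetricOn.mulVec_jetAt (hG : IsMetricOn G U) (hV : IsOpen V) (hVU : V ⊆ U)
    (ha : IsKillingOn G V a) (k : ℕ) {x : Coord n} (hx : x ∈ V) :
    (prolongationMatrix G d k x).mulVec (jetAt k a x) = 0 := by
  induction k generalizing x with
  | zero =>
    ext ⟨τ, β⟩
    have hβ : β.1 = 0 := (Finsupp.degree_eq_zero_iff _).1 (Nat.le_zero.1 β.2)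
    rw [mulVec_prolongationMatrix, hβ, iterOp_zero]
    exact (hG.poissonBracket_eq_zero_iff (hVU hx) hV hx ha.1).1 (ha.2 x hx) τ
  | succ k ih =>
    ext ⟨τ, β, hβ⟩
    rw [mulVec_prolongationMatrix]
    rcases hβ.lt_or_eq with hlt | heq
    · have hle := Nat.lt_succ_iff.1 hlt
      rw [hG.evalJet_trunc (hVU hx) τ hle]
      exact congrFun (ih hx) (τ, ⟨β, hle⟩)
    · obtain ⟨β', q, rfl, hβ'⟩ := exists_eq_add_single heq
      have hF := (commuteUpTo_totalDeriv hG.isOpen).mem_iterOp β'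
        (hG.smoothJet_killingEquation (d := d) τ)
      -- The induction hypothesis is an identity on all of the open set `V`, which is what permits
      -- differentiating it at `x`.
      have h0 : Set.EqOn (fun y => ∑ v : JetVar n d k,
          iterOp totalDeriv β' (killingEquation G d τ) v.1 v.2.1 y * jetAt k a y v) 0 V :=
        fun y hy => congrFun (ih hy) (τ, ⟨β', hβ'.le⟩)
      have h1 := eqOn_pd hV h0 q hx
      rw [pd_zero] at h1
      have h2 : HasFDerivAt (fun y => ∑ v : JetVar n d k,
          iterOp totalDeriv β' (killingEquation G d τ) v.1 v.2.1 y * jetAt k a y v) _ x :=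
        HasFDerivAt.fun_sum fun v _ =>
          (differentiableAt_of_smoothOn (hF v.1 v.2.1) hG.isOpen (hVU hx)).hasFDerivAt.mul
            (hasFDerivAt_pi'.1 (hasFDerivAt_jetAt hV ha.1 k hx) v)
      rw [hasFDerivAt_pd h2] at h1
      rw [hG.evalJet_add_single (hVU hx) τ hβ'.le]
      rw [Pi.zero_apply] at h1 ⊢
      rw [← h1, evalJet, evalJet, ← Finset.sum_add_distrib]
      simp only [sum_apply]
      refine Finset.sum_congr rfl fun v _ => ?_
      have e1 : truncL n d (k + 1) (jetAt (k + 1) a x) v = jetAt k a x v := rfl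
      rw [e1]
      simp only [add_apply, smul_apply, ContinuousLinearMap.comp_apply,
        ContinuousLinearMap.proj_apply, ContinuousLinearMap.flip_apply, dirShift_single,
        smul_eq_mul, pd]
      ring

lemma IsMetricOn.isKillingOn_of_mulVec (hG : IsMetricOn G U) (hV : IsOpen V) (hVU : V ⊆ U)
    (ha : ∀ I, ContDiffOn ℝ ∞ (a I) V) (k : ℕ)
    (hM : ∀ x ∈ V, (prolongationMatrix G d k x).mulVec (jetAt k a x) = 0) : IsKillingOn G V a := by
  induction k with
  | zero =>
    refine ⟨ha, fun x hx => ?_⟩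
    rw [hG.poissonBracket_eq_zero_iff (hVU hx) hV hx ha]
    intro τ
    have := congrFun (hM x hx) (τ, ⟨0, by simp⟩)
    rwa [mulVec_prolongationMatrix, iterOp_zero] at this
  | succ k ih => exact ih fun x hx => hG.truncL_mem (hVU hx) (hM x hx)

/-- A section of the jet bundle whose derivatives are given by its higher order components is the
jet of a function. -/
lemma jetAt_eq_of_hasFDerivAt (hV : IsOpen V) {k : ℕ} {ξ : Coord n → JetVar n d (k + 1) → ℝ}
    (hs : ∀ x ∈ V, HasFDerivAt (fun y => truncL n d (k + 1) (ξ y))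
      ((dirShift n d (k + 1)).flip (ξ x)) x)
    (ha : ∀ I, ContDiffOn ℝ ∞ (fun y => ξ y (I, ⟨0, by simp⟩)) V) {x : Coord n} (hx : x ∈ V) :
    jetAt k (fun I y => ξ y (I, ⟨0, by simp⟩)) x = truncL n d (k + 1) (ξ x) := by
  ext ⟨I, β, hβ⟩
  obtain ⟨m, hm⟩ : ∃ m, β.degree = m := ⟨_, rfl⟩
  induction m generalizing β x with
  | zero =>
    obtain rfl := (Finsupp.degree_eq_zero_iff β).1 hm
    simp only [jetAt, iterOp_zero]
    rfl
  | succ m ih =>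
    obtain ⟨β', q, rfl, hβ'⟩ := exists_eq_add_single hm
    have hle : β'.degree ≤ k + 1 := by omega
    have h1 : Set.EqOn (iterOp pd β' fun y => ξ y (I, ⟨0, by simp⟩))
        (fun y => truncL n d (k + 1) (ξ y) (I, ⟨β', hle⟩)) V := fun y hy => ih hy β' hle hβ'
    have h2 := hasFDerivAt_pd (hasFDerivAt_pi'.1 (hs x hx) (I, ⟨β', hle⟩)) q
    refine ((commuteUpTo_pd hV).iterOp_add_single β' q (ha I) hx).trans
      ((eqOn_pd hV h1 q hx).trans (h2.trans ?_))
    rw [ContinuousLinearMap.comp_apply, ContinuousLinearMap.flip_apply, dirShift_single]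
    rfl

lemma iterOp_pd_lin (hV : IsOpen V) (c : ℝ) {f h : Coord n → ℝ} (hf : ContDiffOn ℝ ∞ f V)
    (hh : ContDiffOn ℝ ∞ h V) (β : Fin n →₀ ℕ) :
    Set.EqOn (iterOp pd β fun y => c * f y + h y)
      (fun y => c * iterOp pd β f y + iterOp pd β h y) V := by
  obtain ⟨m, hm⟩ : ∃ m, β.degree = m := ⟨_, rfl⟩
  induction m generalizing β with
  | zero =>
    obtain rfl := (Finsupp.degree_eq_zero_iff β).1 hm
    simp only [iterOp_zero]
    exact Set.eqOn_refl _ _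
  | succ m ih =>
    obtain ⟨β', q, rfl, hβ'⟩ := exists_eq_add_single hm
    intro x hx
    have hC := commuteUpTo_pd hV
    refine (hC.iterOp_add_single β' q ((contDiffOn_const.mul hf).add hh) hx).trans
      ((eqOn_pd hV (ih β' hβ') q hx).trans ?_)
    rw [pd_lin q c (differentiableAt_of_smoothOn (hC.mem_iterOp β' hf) hV hx)
      (differentiableAt_of_smoothOn (hC.mem_iterOp β' hh) hV hx)]
    simp only [hC.iterOp_add_single β' q hf hx, hC.iterOp_add_single β' q hh hx]

lemma jetAt_lin (hV : IsOpen V) (c : ℝ) (ha : ∀ I, ContDiffOn ℝ ∞ (a I) V)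
    (hb : ∀ I, ContDiffOn ℝ ∞ (b I) V) (k : ℕ) {x : Coord n} (hx : x ∈ V) :
    jetAt k (c • a + b) x = c • jetAt k a x + jetAt k b x := by
  ext v
  exact iterOp_pd_lin hV c (ha v.1) (hb v.1) v.2.1 hx

lemma iterOp_pd_zero (β : Fin n →₀ ℕ) : iterOp pd β (0 : Coord n → ℝ) = 0 := by
  ext x
  -- Linearity with factor `-1` and both functions zero reads `D_β 0 = -D_β 0 + D_β 0`.
  have := iterOp_pd_lin isOpen_univ (-1) (contDiffOn_const (c := (0 : ℝ)))
    (contDiffOn_const (c := (0 : ℝ))) β (Set.mem_univ x)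
  simp only [mul_zero, add_zero, neg_one_mul, neg_add_cancel] at this
  exact this

lemma jetAt_zero (k : ℕ) (x : Coord n) : jetAt k (0 : MultiEq n d → Coord n → ℝ) x = 0 := by
  ext v
  exact congrFun (iterOp_pd_zero v.2.1) x

lemma iterOp_pd_congr (hV : IsOpen V) {f h : Coord n → ℝ} (hfh : Set.EqOn f h V)
    (β : Fin n →₀ ℕ) : Set.EqOn (iterOp pd β f) (iterOp pd β h) V := by
  unfold iterOp
  induction List.finRange n with
  | nil => exact hfh
  | cons r l ih =>
    rw [List.foldr_cons, List.foldr_cons]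
    induction β r with
    | zero => exact ih
    | succ k ih' =>
      rw [Function.iterate_succ_apply', Function.iterate_succ_apply']
      exact eqOn_pd hV ih' r

variable {x₀ : Coord n}

lemma IsMetricOn.mulVec_jetAt_of_killingNear (hG : IsMetricOn G U) (hx₀ : x₀ ∈ U)
    (ha : a ∈ killingNear G d x₀) (k : ℕ) :
    (prolongationMatrix G d k x₀).mulVec (jetAt k a x₀) = 0 := by
  obtain ⟨V, hV, hxV, haV⟩ := ha
  exact hG.mulVec_jetAt (hV.inter hG.isOpen) Set.inter_subset_right
    ⟨fun I => (haV.1 I).mono Set.inter_subset_left, fun x hx => haV.2 x hx.1⟩ k ⟨hxV, hx₀⟩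

/-- The `(k + 1)`-jets at `x₀` of local Killing tensors, as a linear map. -/
noncomputable def jetMap (G : Coord n → Matrix (Fin n) (Fin n) ℝ) (d k : ℕ) (x₀ : Coord n) :
    killingNear G d x₀ →ₗ[ℝ] (JetVar n d k → ℝ) where
  toFun a := jetAt k a.1 x₀
  map_add' := by
    rintro ⟨a, V, hV, hxV, ha⟩ ⟨b, W, hW, hxW, hb⟩
    have := jetAt_lin (hV.inter hW) 1 (fun I => (ha.1 I).mono Set.inter_subset_left)
      (fun I => (hb.1 I).mono Set.inter_subset_right) k ⟨hxV, hxW⟩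
    simpa using this
  map_smul' := by
    rintro c ⟨a, V, hV, hxV, ha⟩
    have := jetAt_lin hV c ha.1 (b := 0) (fun I => contDiffOn_const) k hxV
    simpa [jetAt_zero] using this

section FiniteType

/-! ### Germs of Killing tensors and the solution space of a stabilized prolongation. -/

variable {k : ℕ} (hG : IsMetricOn G U) (hx₀ : x₀ ∈ U)
  (hreg : ∀ k, ∀ x ∈ U, (prolongationMatrix G d k x).rank ≤ (prolongationMatrix G d k x₀).rank)
  (hk : d ≤ k) (hδ : corank G d x₀ (k + 1) = corank G d x₀ k)

include hG hx₀ hreg hk hδ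

/-- The general existence theorem yields a section of the jet bundle; its order zero components are
the Killing tensor, because the section is then their jet. -/
lemma IsMetricOn.exists_killing (s : JetVar n d k → ℝ)
    (hs : (prolongationMatrix G d k x₀).mulVec s = 0) :
    ∃ a ∈ killingNear G d x₀, jetAt k a x₀ = s := by
  obtain ⟨U', hU'U, hxU', hsys⟩ := hG.exists_finiteTypeSystem hx₀ hreg hk hδ
  obtain ⟨W, ξ, hW, hxW, hWU', hξ, h0, hsol⟩ := hsys.exists_solution hxU' hs
  have ha : ∀ I, ContDiffOn ℝ ∞ (fun y => ξ y (I, ⟨0, by simp⟩)) W := fun I =>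
    contDiffOn_pi.1 hξ _
  have hj : ∀ x ∈ W, jetAt k (fun I y => ξ y (I, ⟨0, by simp⟩)) x = truncL n d (k + 1) (ξ x) :=
    fun x hx => jetAt_eq_of_hasFDerivAt hW (fun y hy => (hsol y hy).2) ha hx
  have hWU := hWU'.trans hU'U
  refine ⟨_, ⟨W, hW, hxW, hG.isKillingOn_of_mulVec hW hWU ha k fun x hx => ?_⟩,
    (hj x₀ hxW).trans h0⟩
  rw [hj x hx]
  exact hG.truncL_mem (hWU hx) (hsol x hx).1

lemma IsMetricOn.killing_unique (ha : a ∈ killingNear G d x₀) (h0 : jetAt k a x₀ = 0) :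
    a ∈ vanishNear n d x₀ := by
  obtain ⟨U', hU'U, hxU', hsys⟩ := hG.exists_finiteTypeSystem hx₀ hreg hk hδ
  obtain ⟨V, hV, hxV, haV⟩ := ha
  have hVU' := hV.inter hsys.isOpen
  have haV' : IsKillingOn G (V ∩ U') a :=
    ⟨fun I => (haV.1 I).mono Set.inter_subset_left, fun x hx => haV.2 x hx.1⟩
  have := hsys.solution_unique hxU' hVU' ⟨hxV, hxU'⟩ (ξ := fun x => jetAt (k + 1) a x) h0
    fun x hx => ⟨hG.mulVec_jetAt hVU' (Set.inter_subset_right.trans hU'U) haV' (k + 1) hx,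
      hasFDerivAt_jetAt hVU' haV'.1 k hx⟩
  filter_upwards [this] with x hx I
  have h1 := congrFun hx (I, ⟨0, by simp⟩)
  have h2 : truncL n d (k + 1) (jetAt (k + 1) a x) (I, ⟨0, by simp⟩) = iterOp pd 0 (a I) x := rfl
  rwa [h2, iterOp_zero] at h1

lemma IsMetricOn.ker_jetMap :
    (jetMap G d k x₀).ker = (vanishNear n d x₀).submoduleOf (killingNear G d x₀) := by
  ext a
  rw [LinearMap.mem_ker]
  constructor
  · intro h
    exact hG.killing_unique hx₀ hreg hk hδ a.2 h
  · intro h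
    obtain ⟨W, hW, hWo, hxW⟩ := eventually_nhds_iff.1 (show ∀ᶠ x in 𝓝 x₀, ∀ I, a.1 I x = 0 from h)
    ext v
    have h1 : Set.EqOn (a.1 v.1) 0 W := fun x hx => hW x hx v.1
    exact (iterOp_pd_congr hWo h1 v.2.1 hxW).trans (congrFun (iterOp_pd_zero v.2.1) x₀)

lemma IsMetricOn.range_jetMap :
    (jetMap G d k x₀).range = (matCLM (prolongationMatrix G d k x₀)).ker := by
  ext s
  constructor
  · rintro ⟨a, rfl⟩
    exact hG.mulVec_jetAt_of_killingNear hx₀ a.2 k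
  · intro hs
    obtain ⟨a, ha, rfl⟩ := hG.exists_killing hx₀ hreg hk hδ s hs
    exact ⟨⟨a, ha⟩, rfl⟩

/-- Taking the jet at `x₀` identifies germs with `ker M_k(x₀)`: uniqueness computes the kernel of
`jetMap`, existence its range. -/
theorem IsMetricOn.finrank_killingGerms : Module.Finite ℝ (KillingGerms G d x₀) ∧
    Module.finrank ℝ (KillingGerms G d x₀) = corank G d x₀ k := by
  let e : KillingGerms G d x₀ ≃ₗ[ℝ] (matCLM (prolongationMatrix G d k x₀)).ker :=
    (Submodule.quotEquivOfEq _ _ (hG.ker_jetMap hx₀ hreg hk hδ).symm).trans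
      ((jetMap G d k x₀).quotKerEquivRange.trans
        (LinearEquiv.ofEq _ _ (hG.range_jetMap hx₀ hreg hk hδ)))
  refine ⟨Module.Finite.equiv e.symm, ?_⟩
  rw [e.finrank_eq, finrank_ker_matCLM, corank]

/-- No new integration is needed above `k`: the Killing tensor found for the truncation of `ξ` has a
jet that solves the same prolongation and agrees with `ξ` in lower order, and such a solution is
unique. -/
theorem IsMetricOn.exists_killing_of_le {l : ℕ} (hl : k ≤ l) (ξ : JetVar n d l → ℝ)
    (hξ : (prolongationMatrix G d l x₀).mulVec ξ = 0) :
    ∃ a ∈ killingNear G d x₀, jetAt l a x₀ = ξ := by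
  induction l, hl using Nat.le_induction with
  | base => exact hG.exists_killing hx₀ hreg hk hδ ξ hξ
  | succ l hl ih =>
    obtain ⟨a, ha, hal⟩ := ih _ (hG.truncL_mem hx₀ hξ)
    refine ⟨a, ha, sub_eq_zero.1 (hG.eq_zero_of_truncL_eq_zero hx₀
      ((hk.trans hl).trans (Nat.le_succ l)) ?_ ?_)⟩
    · rw [Matrix.mulVec_sub, hG.mulVec_jetAt_of_killingNear hx₀ ha, hξ, sub_zero]
    · rw [map_sub, sub_eq_zero]
      exact hal

end FiniteType

/-! ### The projections between the prolongations -/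

/-- The projection from the solutions of one prolongation to those of the previous one. -/
noncomputable def IsMetricOn.kerProj (hG : IsMetricOn G U) (hx₀ : x₀ ∈ U) (d k : ℕ) :
    (matCLM (prolongationMatrix G d (k + 1) x₀)).ker →ₗ[ℝ]
      (matCLM (prolongationMatrix G d k x₀)).ker :=
  (truncL n d (k + 1) : _ →ₗ[ℝ] _).restrict fun _ hξ => hG.truncL_mem hx₀ hξ

lemma IsMetricOn.kerProj_injective (hG : IsMetricOn G U) (hx₀ : x₀ ∈ U) {k : ℕ} (hk : d ≤ k) :
    Function.Injective (hG.kerProj hx₀ d k) := by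
  rw [injective_iff_map_eq_zero]
  intro ξ h
  exact Subtype.ext (hG.eq_zero_of_truncL_eq_zero hx₀ (hk.trans (Nat.le_succ k)) ξ.2
    (congrArg Subtype.val h))

lemma IsMetricOn.corank_succ_le (hG : IsMetricOn G U) (hx₀ : x₀ ∈ U) {k : ℕ} (hk : d ≤ k) :
    corank G d x₀ (k + 1) ≤ corank G d x₀ k := by
  have := LinearMap.finrank_le_finrank_of_injective (hG.kerProj_injective hx₀ hk)
  rwa [finrank_ker_matCLM, finrank_ker_matCLM] at this

/-- A surjective projection would be bijective, since it is already injective for `k ≥ d`, and the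
coranks would agree. -/
lemma IsMetricOn.exists_not_projection (hG : IsMetricOn G U) (hx₀ : x₀ ∈ U) {k : ℕ} (hk : d ≤ k)
    (hne : corank G d x₀ (k + 1) ≠ corank G d x₀ k) :
    ∃ ξ ∈ prolongationFibre G d k x₀, ∀ η ∈ prolongationFibre G d (k + 1) x₀, jetProj η ≠ ξ := by
  by_contra! hcon
  refine hne ?_
  have hsurj : Function.Surjective (hG.kerProj hx₀ d k) := by
    rintro ⟨ξ, hξ⟩
    obtain ⟨η, hη, hηξ⟩ := hcon ξ hξ
    exact ⟨⟨η, hη⟩, Subtype.ext hηξ⟩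
  have := (LinearEquiv.ofBijective _ ⟨hG.kerProj_injective hx₀ hk, hsurj⟩).finrank_eq
  rwa [finrank_ker_matCLM, finrank_ker_matCLM] at this

end KillingJets

/-! ### The algorithm -/

section Algorithm

variable {δ : ℕ → ℕ} {d : ℕ}

lemma not_loopContinues_iff {k : ℕ} : ¬ LoopContinues δ d k ↔ d < k ∧ δ k = δ (k - 1) := by
  unfold LoopContinues
  constructor
  · intro h
    push Not at h
    exact ⟨h.1, h.2 h.1⟩
  · rintro ⟨h1, h2⟩ (h | h)
    · omega
    · exact h.2 h2

lemma LoopReturns.spec {j : ℕ} {r : ℕ × ℕ} (h : LoopReturns δ d j r) :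
    ¬ LoopContinues δ d r.2 ∧ r.1 = δ r.2 ∧ ∀ i, j ≤ i → i < r.2 → LoopContinues δ d i := by
  induction h with
  | again k r hk _ ih =>
    refine ⟨ih.1, ih.2.1, fun i hi hir => ?_⟩
    rcases hi.eq_or_lt with rfl | hlt
    · exact hk
    · exact ih.2.2 i hlt hir
  | halt k hk => exact ⟨hk, rfl, fun i hi hik => by omega⟩

lemma exists_loopReturns (m : ℕ) {j : ℕ} (h : ¬ LoopContinues δ d (j + m)) :
    ∃ r, LoopReturns δ d j r := by
  induction m generalizing j with
  | zero => exact ⟨_, .halt j h⟩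
  | succ m ih =>
    by_cases hj : LoopContinues δ d j
    · obtain ⟨r, hr⟩ := ih (j := j + 1) (by rwa [add_right_comm, add_assoc])
      exact ⟨r, .again j r hj hr⟩
    · exact ⟨_, .halt j hj⟩

/-- Otherwise `δ` would decrease strictly at every step from `d` on, which is impossible for more
than `δ d` steps. -/
lemma exists_not_loopContinues (hδ : ∀ k, d ≤ k → δ (k + 1) ≤ δ k) :
    ∃ k, ¬ LoopContinues δ d k := by
  by_contra! hcon
  have hlt : ∀ m, δ (d + m) + m ≤ δ d := by
    intro m
    induction m with
    | zero => simp
    | succ m ih =>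
      have h1 := hδ (d + m) (by omega)
      have h2 : δ (d + m + 1) ≠ δ (d + m) := by
        rcases hcon (d + m + 1) with h | h
        · omega
        · exact h.2
      have e : d + (m + 1) = d + m + 1 := by omega
      rw [e]
      omega
  have := hlt (δ d + 1)
  omega

end Algorithm

/-! ### The metric in a chart -/

/-- The coordinate matrix is the Gram matrix in the basis that the invertible differential of
`φ.symm` makes from the standard one; nondegeneracy is then its nonzero determinant. -/
lemma isMetricOn_inChart {n : ℕ} {N : Type*} [TopologicalSpace N]
    [ChartedSpace (Coord n) N] [IsManifold (𝓡 n) ∞ N] (g : PseudoRiemannianMetric n N)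
    {φ : OpenPartialHomeomorph N (Coord n)} (hφ : φ ∈ IsManifold.maximalAtlas (𝓡 n) ∞ N) :
    IsMetricOn (g.inChart φ) φ.target := by
  refine ⟨φ.open_target, fun i j => g.smooth φ hφ i j, fun x hx => ?_, fun x hx => ?_⟩
  · ext i j
    exact (g.symm (φ.symm x)).eq _ _
  · have hφ' : φ.MDifferentiable (𝓡 n) (𝓡 n) :=
      ⟨fun y hy => ((contMDiffAt_of_mem_maximalAtlas hφ hy).mdifferentiableAt
          (by simp)).mdifferentiableWithinAt,
        fun y hy => ((contMDiffAt_symm_of_mem_maximalAtlas hφ hy).mdifferentiableAt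
          (by simp)).mdifferentiableWithinAt⟩
    let L := (hφ'.symm.mfderiv hx).toLinearEquiv
    let B : Module.Basis (Fin n) ℝ (TangentSpace (𝓡 n) (φ.symm x)) :=
      (EuclideanSpace.basisFun (Fin n) ℝ).toBasis.map L
    have hB : ∀ i, B i = mfderiv (𝓡 n) (𝓡 n) φ.symm x
        (EuclideanSpace.single i (1 : ℝ) : Coord n) := fun i => by
      have e : (EuclideanSpace.basisFun (Fin n) ℝ).toBasis i = EuclideanSpace.single i (1 : ℝ) := by
        simp
      exact (Module.Basis.map_apply _ L i).trans (congrArg L e)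
    have h1 : g.inChart φ x = LinearMap.BilinForm.toMatrix B (g.form (φ.symm x)) := by
      ext i j
      rw [LinearMap.BilinForm.toMatrix_apply, hB, hB]
      rfl
    rw [Matrix.isUnit_iff_isUnit_det, h1, isUnit_iff_ne_zero]
    exact (LinearMap.BilinForm.nondegenerate_iff_det_ne_zero B).1 (g.nondegenerate _)

end KillingProlongation

/-! ### The proposition. -/

open KillingProlongation in
theorem mainTheorem9 {n : ℕ} {N : Type*} [TopologicalSpace N]
    [ChartedSpace (EuclideanSpace ℝ (Fin n)) N] [IsManifold (𝓡 n) ∞ N]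
    (g : KillingProlongation.PseudoRiemannianMetric n N) (d : ℕ)
    (φ : OpenPartialHomeomorph N (EuclideanSpace ℝ (Fin n)))
    (hφ : φ ∈ IsManifold.maximalAtlas (𝓡 n) ∞ N) (x₀ : N)
    (hx₀ : KillingProlongation.IsRegularPoint g d φ x₀) :
    -- termination
    (∃ r, KillingProlongation.AlgorithmReturns (g.inChart φ) d (φ x₀) r) ∧
    -- correctness of every returned pair
    ∀ δ k, KillingProlongation.AlgorithmReturns (g.inChart φ) d (φ x₀) (δ, k) →
      -- the algorithm halts at the first `k > d` with `δ_k = δ_{k-1}` and returns this `δ_k`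
      (IsLeast {m | d < m ∧ KillingProlongation.corank (g.inChart φ) d (φ x₀) m
          = KillingProlongation.corank (g.inChart φ) d (φ x₀) (m - 1)} k ∧
        δ = KillingProlongation.corank (g.inChart φ) d (φ x₀) k) ∧
      -- `dim K_d = δ_k`
      (Module.Finite ℝ (KillingProlongation.KillingGerms (g.inChart φ) d (φ x₀)) ∧
        Module.finrank ℝ (KillingProlongation.KillingGerms (g.inChart φ) d (φ x₀)) = δ) ∧
      -- all compatibility conditions have been found: every point over `x₀` of the prolongation
      -- of order `k - 1` or higher is the jet of a local Killing tensor
      (∀ l, k ≤ l + 1 → ∀ ξ ∈ KillingProlongation.prolongationFibre (g.inChart φ) d l (φ x₀),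
        ∃ a ∈ KillingProlongation.killingNear (g.inChart φ) d (φ x₀),
          KillingProlongation.jetAt l a (φ x₀) = ξ) ∧
      -- and from the Frobenius level `d` on no smaller number of prolongations suffices
      (∀ m, d ≤ m → m + 1 < k →
        ∃ ξ ∈ KillingProlongation.prolongationFibre (g.inChart φ) d m (φ x₀),
          ∀ η ∈ KillingProlongation.prolongationFibre (g.inChart φ) d (m + 1) (φ x₀),
            KillingProlongation.jetProj η ≠ ξ) := by
  have hG := isMetricOn_inChart g hφ
  have hx : φ x₀ ∈ φ.target := φ.map_source hx₀.1
  have hreg : ∀ k, ∀ x ∈ φ.target, (prolongationMatrix (g.inChart φ) d k x).rank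
      ≤ (prolongationMatrix (g.inChart φ) d k (φ x₀)).rank := fun k x hx => by
    have := hx₀.2 k (φ.symm x) (φ.map_target hx)
    rwa [φ.right_inv hx] at this
  refine ⟨?_, fun δ k hret => ?_⟩
  · obtain ⟨k, hk⟩ := exists_not_loopContinues (δ := corank (g.inChart φ) d (φ x₀))
      fun k hk => hG.corank_succ_le hx hk
    exact exists_loopReturns k (by rwa [zero_add])
  · obtain ⟨hhalt, hδ, hcont⟩ := LoopReturns.spec hret
    rw [not_loopContinues_iff] at hhalt
    obtain ⟨hdk, heq⟩ := hhalt
    -- The halting counter is written `k + 1`, so the repetition is `δ_{k+1} = δ_k` and the strict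
    -- bound on the counter becomes `d ≤ k`, the range in which the symbol is injective.
    obtain ⟨k, rfl⟩ : ∃ k', k = k' + 1 := ⟨k - 1, by dsimp only at hdk; omega⟩
    have hk : d ≤ k := Nat.lt_succ_iff.1 hdk
    refine ⟨⟨⟨⟨hdk, heq⟩, fun m hm => ?_⟩, hδ⟩, ?_, fun l hl ξ hξ => ?_, fun m hdm hmk => ?_⟩
    · by_contra! hlt
      exact not_loopContinues_iff.2 hm (hcont m (Nat.zero_le m) hlt)
    · rw [show δ = corank (g.inChart φ) d (φ x₀) k from hδ.trans heq]
      exact hG.finrank_killingGerms hx hreg hk heq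
    · exact hG.exists_killing_of_le hx hreg hk heq (Nat.succ_le_succ_iff.1 hl) ξ hξ
    · refine hG.exists_not_projection hx hdm fun h => ?_
      -- A repetition at `m + 1` would have stopped the loop there, before the counter that was
      -- returned.
      exact not_loopContinues_iff.2 ⟨Nat.lt_succ_iff.2 hdm, h⟩ (hcont (m + 1) (Nat.zero_le _) hmk)
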